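/- Fix a countably infinite set $\mathbb A$ of names and let $\mathrm{Perm}\,\mathbb A$ be the group of finite permutations of $\mathbb A$. A set $S\subseteq\mathbb A$ supports an element $x$ of a $\mathrm{Perm}\,\mathbb A$-set if every $\pi\in\mathrm{Perm}\,\mathbb A$ fixing $S$ pointwise satisfies $\pi\cdot x=x$. A nominal set is a $\mathrm{Perm}\,\mathbb A$-set all of whose elements have a finite support; $\operatorname{supp}x$ denotes the least finite support of $x$. A nominal set is orbit-finite if it has finitely many orbits, $k$-bounded if $|\operatorname{supp}x|\le k$ for all $x$, and strong if $\pi\cdot x=x$ holds only for those $\pi$ that fix $\operatorname{supp}x$ pointwise. A nominal monoid is a nominal set with a monoid structure whose multiplication and unit are equivariant; morphisms are equivariant monoid morphisms, and nominal submonoids are submonoids closed under the action. **MSR-pseudovarieties.** A surjective morphism $e\colon M\to N$ of nominal monoids is an MSR (multiplicatively support-reflecting) quotient if there is a nominal submonoid $M'\subseteq M$ with $e[M']=N$ and $\operatorname{supp}e(x)=\operatorname{supp}x$ for all $x\in M'$. An MSR-pseudovariety is a class of orbit-finite nominal monoids closed under finite products (including the empty one), nominal submonoids and MSR quotients. **Nominal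 Stone spaces.** A nominal topology on a nominal set $X$ is an equivariant family of finitely supported subsets of $X$ (the open sets), closed under finitely supported unions and finite intersections; it is discrete if all finitely supported subsets are open. A map is continuous if it is equivariant and preimages of open sets are open. $X$ is compact if every finitely supported open cover has a finitely supported, orbit-finite subcover; it is Hausdorff if for every finite $S\subseteq\mathbb A$ any two points in different $S$-orbits (orbits of the group of finite permutations fixing $S$ pointwise) have disjoint $S$-supported open neighbourhoods. A subset is representable if it is the preimage of a finitely supported subset under a continuous map to an orbit-finite discrete space. A nominal Stone space is a compact Hausdorff nominal space with an equivariant basis of representable sets, where a basis is required to yield every open set as a finitely supported union of its members. **Pro-orbit-finite words.** Let $\Sigma$ be an orbit-finite nominal set and $\Sigma^*$ the nominal monoid of words. A support bound is a map $s$ from $\Sigma^*$ to subsets of $\mathbb A$ such that, for some $k$, $|s(w)|\le k$ for all $w$. A morphism $h\colon\Sigma^*\to M$ of nominal monoids is $s$-bounded if $\operatorname{supp}h(w)\subseteq s(w)$ for all $w$. The space $\widehat{\Sigma^*_s}$ of $s$-bounded pro-orbit-finite words is the limit of all $s$-bounded surjective morphisms $e\colon\Sigma^*\to M$ with $M$ orbit-finite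 (ordered by factorization): its elements are the finitely supported compatible families, with the initial topology for the projections to the discrete spaces $M$. For every $s$-bounded morphism $h\colon\Sigma^*\to M$ into an orbit-finite nominal monoid, $\hat h\colon\widehat{\Sigma^*_s}\to M$ denotes the projection to the image of $h$ followed by the inclusion into $M$. **Proequations.** A morphic proequation is a surjective continuous equivariant map $\varphi\colon\widehat{\Sigma^*_s}\to E$, where $\Sigma$ is a strong orbit-finite nominal set, $s$ is a support bound on $\Sigma^*$, and $E$ is a nominal Stone space. An orbit-finite nominal monoid $M$ satisfies $\varphi$ if for every $s$-bounded morphism $h\colon\Sigma^*\to M$ one has $\hat h=g\circ\varphi$ for some continuous equivariant map $g\colon E\to M$, where $M$ is discrete (and the factorization is taken among $k$-bounded nominal Stone spaces, for some $k$ bounding the supports of $M$ and the support bound $s$). A class of orbit-finite nominal monoids is presentable by morphic proequations if it consists precisely of the orbit-finite nominal monoids satisfying all members of some set of morphic proequations (possibly over different $\Sigma$ and $s$). **Theorem (Nominal Reiterman).** A class of orbit-finite nominal monoids is an MSR-pseudovariety if and only if it is presentable by morphic proequations. -/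

import Mathlib

open scoped Pointwise

universe u

namespace Nominal

/-! ### Nominal sets -/

section NominalSets

/-- The group of finite permutations of the set `𝔸` of names. It acts on `𝔸` by application. -/
def FinPerm (𝔸 : Type) : Subgroup (Equiv.Perm 𝔸) where
  carrier := {π | {a | π a ≠ a}.Finite}
  one_mem' := by simp
  mul_mem' := by
    intro π σ hπ hσ
    refine (hπ.union hσ).subset fun a ha => ?_
    by_contra hcon
    simp only [Set.mem_union, Set.mem_ofPred_eq, not_or, not_not] at hcon
    exact ha (by rw [Equiv.Perm.mul_apply, hcon.2, hcon.1])
  inv_mem' := by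
    intro π hπ
    refine Set.Finite.subset hπ fun a ha hcon => ha ?_
    exact (Equiv.Perm.inv_eq_iff_eq).2 hcon.symm

variable (𝔸 : Type) {X Y : Type u} [MulAction (FinPerm 𝔸) X] [MulAction (FinPerm 𝔸) Y]

/-- `x` has a finite support: there is a finite set `S` of names such that every finite
permutation that fixes all elements of `S` also fixes `x`. Applied to `x : Set X` or
`x : Set (Set X)`, this refers to the action `π • U = {π • y | y ∈ U}` on subsets. -/
def FinSupp {X : Type u} [MulAction (FinPerm 𝔸) X] (x : X) : Prop :=
  ∃ S : Finset 𝔸, MulAction.Supports (FinPerm 𝔸) (S : Set 𝔸) x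

/-- The intersection of all finite supports of `x`; if `x` has a finite support (and there are
infinitely many names), this is the least finite support of `x`. -/
def supp {X : Type u} [MulAction (FinPerm 𝔸) X] (x : X) : Set 𝔸 :=
  {a | ∀ S : Finset 𝔸, MulAction.Supports (FinPerm 𝔸) (S : Set 𝔸) x → a ∈ S}

/-- A set with an action of the finite permutations is a nominal set if every element has a
finite support. -/
class IsNominal (X : Type u) [MulAction (FinPerm 𝔸) X] : Prop where
  finSupp : ∀ x : X, FinSupp 𝔸 x

/-- There are only finitely many orbits. -/
def OrbitFinite (X : Type u) [MulAction (FinPerm 𝔸) X] : Prop :=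
  Finite (MulAction.orbitRel.Quotient (FinPerm 𝔸) X)

/-- All elements have a least support with at most `k` elements. -/
def IsBounded (k : ℕ) (X : Type u) [MulAction (FinPerm 𝔸) X] : Prop :=
  ∀ x : X, (supp 𝔸 x).encard ≤ k

/-- A nominal set is strong if the permutations fixing `x` are exactly those that fix every
name in the least support of `x`. -/
def IsStrong (X : Type u) [MulAction (FinPerm 𝔸) X] : Prop :=
  ∀ (x : X) (π : FinPerm 𝔸), π • x = x ↔ ∀ a ∈ supp 𝔸 x, π • a = a

/-- Equivariant maps. -/
def Equivariant (f : X → Y) : Prop :=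
  ∀ (π : FinPerm 𝔸) (x : X), f (π • x) = π • f x

variable {𝔸}

theorem FinSupp.smul {x : X} (h : FinSupp 𝔸 x) (π : FinPerm 𝔸) : FinSupp 𝔸 (π • x) := by
  obtain ⟨S, hS⟩ := h
  refine ⟨S.map (MulAction.toPerm π).toEmbedding, fun σ hσ => ?_⟩
  have key : (π⁻¹ * σ * π) • x = x := by
    refine hS _ fun a ha => ?_
    have := hσ (a := π • a) (by simpa using ha)
    rw [mul_smul, mul_smul, this, inv_smul_smul]
  rw [mul_smul, mul_smul, inv_smul_eq_iff] at key
  exact key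

/-- Two finitely supported elements have a common finite support. -/
theorem FinSupp.exists_common {x : X} {y : Y} (hx : FinSupp 𝔸 x) (hy : FinSupp 𝔸 y) :
    ∃ S : Finset 𝔸, MulAction.Supports (FinPerm 𝔸) (S : Set 𝔸) x ∧
      MulAction.Supports (FinPerm 𝔸) (S : Set 𝔸) y := by
  classical
  obtain ⟨S, hS⟩ := hx
  obtain ⟨T, hT⟩ := hy
  exact ⟨S ∪ T, hS.mono (by simp), hT.mono (by simp)⟩

theorem FinSupp.inter {U V : Set X} (hU : FinSupp 𝔸 U) (hV : FinSupp 𝔸 V) :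
    FinSupp 𝔸 (U ∩ V) := by
  obtain ⟨S, hS, hT⟩ := hU.exists_common hV
  exact ⟨S, fun σ hσ => by rw [Set.smul_set_inter, hS σ hσ, hT σ hσ]⟩

theorem FinSupp.sUnion {𝒰 : Set (Set X)} (h : FinSupp 𝔸 𝒰) : FinSupp 𝔸 (⋃₀ 𝒰) := by
  obtain ⟨S, hS⟩ := h
  refine ⟨S, fun σ hσ => ?_⟩
  have hfix := hS σ hσ
  have : σ • ⋃₀ 𝒰 = ⋃₀ (σ • 𝒰) := by
    ext x
    simp only [Set.mem_smul_set_iff_inv_smul_mem, Set.mem_sUnion]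
    constructor
    · rintro ⟨U, hU, hx⟩
      refine ⟨σ • U, by simpa using hU, ?_⟩
      rwa [Set.mem_smul_set_iff_inv_smul_mem]
    · rintro ⟨U, hU, hx⟩
      exact ⟨σ⁻¹ • U, hU, by simpa using hx⟩
  rw [this, hfix]

theorem FinSupp.univ : FinSupp 𝔸 (Set.univ : Set X) :=
  ⟨∅, fun _ _ => Set.smul_set_univ⟩

end NominalSets

/-! ### Nominal topology -/

section NominalTopology

/-- A nominal topology on a nominal set: an equivariant family of finitely supported subsets
that is closed under finitely supported unions and finite intersections. -/
structure NomTop (𝔸 : Type) (X : Type u) [MulAction (FinPerm 𝔸) X] where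
  IsOpen : Set X → Prop
  finSupp : ∀ U, IsOpen U → FinSupp 𝔸 U
  smul : ∀ (π : FinPerm 𝔸) U, IsOpen U → IsOpen (π • U)
  sUnion : ∀ 𝒰 : Set (Set X), FinSupp 𝔸 𝒰 → (∀ U ∈ 𝒰, IsOpen U) → IsOpen (⋃₀ 𝒰)
  univ : IsOpen Set.univ
  inter : ∀ U V, IsOpen U → IsOpen V → IsOpen (U ∩ V)

variable {𝔸 : Type} {X Y : Type u} [MulAction (FinPerm 𝔸) X] [MulAction (FinPerm 𝔸) Y]

/-- The discrete topology: all finitely supported subsets are open. -/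
def NomTop.discrete (𝔸 : Type) (X : Type u) [MulAction (FinPerm 𝔸) X] : NomTop 𝔸 X where
  IsOpen U := FinSupp 𝔸 U
  finSupp _ h := h
  smul π _ h := h.smul π
  sUnion _ h _ := h.sUnion
  univ := FinSupp.univ
  inter _ _ hU hV := hU.inter hV

/-- A morphism of nominal topological spaces: an equivariant map such that preimages of open
sets are open. -/
structure IsMorphism (tX : NomTop 𝔸 X) (tY : NomTop 𝔸 Y) (f : X → Y) : Prop where
  equivariant : Equivariant 𝔸 f
  continuous : ∀ U, tY.IsOpen U → tX.IsOpen (f ⁻¹' U)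

/-- Every open cover (that is, finitely supported set of open sets whose union is `X`) has a
finitely supported subcover that meets only finitely many orbits of the action on subsets. -/
def NomTop.IsCompact (tX : NomTop 𝔸 X) : Prop :=
  ∀ 𝒞 : Set (Set X), FinSupp 𝔸 𝒞 → (∀ U ∈ 𝒞, tX.IsOpen U) → ⋃₀ 𝒞 = Set.univ →
    ∃ 𝒟 ⊆ 𝒞, FinSupp 𝔸 𝒟 ∧ ⋃₀ 𝒟 = Set.univ ∧
      (MulAction.orbit (FinPerm 𝔸) '' 𝒟).Finite

/-- Points in different `S`-orbits have disjoint `S`-supported open neighbourhoods. -/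
def NomTop.IsHausdorff (tX : NomTop 𝔸 X) : Prop :=
  ∀ (S : Finset 𝔸) (x₁ x₂ : X),
    (∀ π : FinPerm 𝔸, (∀ a ∈ S, π • a = a) → π • x₁ ≠ x₂) →
    ∃ U₁ U₂ : Set X, tX.IsOpen U₁ ∧ tX.IsOpen U₂ ∧
      MulAction.Supports (FinPerm 𝔸) (S : Set 𝔸) U₁ ∧
      MulAction.Supports (FinPerm 𝔸) (S : Set 𝔸) U₂ ∧
      x₁ ∈ U₁ ∧ x₂ ∈ U₂ ∧ Disjoint U₁ U₂

/-- Preimages of finitely supported subsets of orbit-finite discrete spaces. -/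
def NomTop.IsRepresentable (tX : NomTop 𝔸 X) (R : Set X) : Prop :=
  ∃ (Y : Type u) (_ : MulAction (FinPerm 𝔸) Y) (f : X → Y) (A : Set Y),
    IsNominal 𝔸 Y ∧ OrbitFinite 𝔸 Y ∧ IsMorphism tX (NomTop.discrete 𝔸 Y) f ∧
      FinSupp 𝔸 A ∧ R = f ⁻¹' A

/-- A basis: an equivariant set of open sets such that every open set is a finitely supported
union of members of it. (As finite intersections of open sets are open, these are then also
finitely supported unions of members.) -/
structure NomTop.IsBasis (tX : NomTop 𝔸 X) (ℬ : Set (Set X)) : Prop where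
  isOpen : ∀ B ∈ ℬ, tX.IsOpen B
  smul : ∀ (π : FinPerm 𝔸), ∀ B ∈ ℬ, π • B ∈ ℬ
  exists_sUnion : ∀ U, tX.IsOpen U → ∃ 𝒞 ⊆ ℬ, FinSupp 𝔸 𝒞 ∧ U = ⋃₀ 𝒞

/-- A nominal Stone space: a nominal compact Hausdorff space with a basis of representable
sets. -/
structure NomTop.IsStone (tX : NomTop 𝔸 X) : Prop where
  isCompact : tX.IsCompact
  isHausdorff : tX.IsHausdorff
  exists_basis : ∃ ℬ : Set (Set X), tX.IsBasis ℬ ∧ ∀ B ∈ ℬ, tX.IsRepresentable B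

end NominalTopology

/-! ### Nominal monoids -/

section NominalMonoids

/-- A nominal monoid: a nominal set with a monoid structure whose multiplication and unit are
equivariant. -/
structure NomMon (𝔸 : Type) : Type (u + 1) where
  carrier : Type u
  [monoid : Monoid carrier]
  [action : MulDistribMulAction (FinPerm 𝔸) carrier]
  [nominal : IsNominal 𝔸 carrier]

instance (𝔸 : Type) : CoeSort (NomMon.{u} 𝔸) (Type u) := ⟨NomMon.carrier⟩

variable {𝔸 : Type}

instance (M : NomMon.{u} 𝔸) : Monoid M := M.monoid
instance (M : NomMon.{u} 𝔸) : MulDistribMulAction (FinPerm 𝔸) M := M.action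
instance (M : NomMon.{u} 𝔸) : IsNominal 𝔸 M := M.nominal

/-- Finite products, with componentwise multiplication and action. -/
def NomMon.prod {n : ℕ} (M : Fin n → NomMon.{u} 𝔸) : NomMon.{u} 𝔸 where
  carrier := ∀ i, M i
  nominal := ⟨fun x => by
    classical
    choose S hS using fun i => IsNominal.finSupp (𝔸 := 𝔸) (x i)
    refine ⟨Finset.univ.biUnion S, fun π hπ => funext fun i => ?_⟩
    exact hS i π fun a ha => hπ (by
      simp only [Finset.coe_biUnion, Set.mem_iUnion]
      exact ⟨i, by simp, ha⟩)⟩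

/-- A nominal submonoid of a nominal monoid: a submonoid closed under the action. -/
def IsNominalSubmonoid (M : NomMon.{u} 𝔸) (N : Submonoid M) : Prop :=
  ∀ (π : FinPerm 𝔸), ∀ x ∈ N, π • x ∈ N

/-- A nominal submonoid, as a nominal monoid. -/
def NomMon.sub (M : NomMon.{u} 𝔸) (N : Submonoid M) (hN : IsNominalSubmonoid M N) :
    NomMon.{u} 𝔸 :=
  letI act : MulDistribMulAction (FinPerm 𝔸) N :=
    { smul := fun π x => ⟨π • (x : M), hN π x x.2⟩
      one_smul := fun x => Subtype.ext (one_smul _ (x : M))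
      mul_smul := fun π σ x => Subtype.ext (mul_smul π σ (x : M))
      smul_mul := fun π x y => Subtype.ext (smul_mul' π (x : M) (y : M))
      smul_one := fun π => Subtype.ext (smul_one π : π • (1 : M) = 1) }
  { carrier := N
    monoid := inferInstance
    action := act
    nominal := ⟨fun x => by
      obtain ⟨S, hS⟩ := IsNominal.finSupp (𝔸 := 𝔸) (x : M)
      exact ⟨S, fun π hπ => Subtype.ext (hS π hπ)⟩⟩ }

/-- A multiplicatively support-reflecting (MSR) quotient: a surjective equivariant monoid
morphism that restricts to a surjective support-preserving morphism on some nominal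
submonoid. -/
structure IsMSRQuotient {M N : NomMon.{u} 𝔸} (e : M →* N) : Prop where
  equivariant : Equivariant 𝔸 e
  surjective : Function.Surjective e
  exists_submonoid : ∃ M' : Submonoid M, IsNominalSubmonoid M M' ∧
    (∀ y, ∃ x ∈ M', e x = y) ∧ ∀ x ∈ M', supp 𝔸 (e x) = supp 𝔸 x

/-- An MSR-pseudovariety: a class of orbit-finite nominal monoids that is closed under finite
products, nominal submonoids and MSR quotients. -/
structure IsMSRPseudovariety (𝒱 : Set (NomMon.{u} 𝔸)) : Prop where
  orbitFinite : ∀ M ∈ 𝒱, OrbitFinite 𝔸 M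
  prod : ∀ (n : ℕ) (M : Fin n → NomMon.{u} 𝔸), (∀ i, M i ∈ 𝒱) → NomMon.prod M ∈ 𝒱
  sub : ∀ M ∈ 𝒱, ∀ (N : Submonoid M) (hN : IsNominalSubmonoid M N), M.sub N hN ∈ 𝒱
  quotient : ∀ M ∈ 𝒱, ∀ (N : NomMon.{u} 𝔸) (e : M →* N), IsMSRQuotient e → N ∈ 𝒱

end NominalMonoids

/-! ### Pro-orbit-finite words -/

section ProWords

variable {𝔸 : Type} {Sg : Type u} [MulAction (FinPerm 𝔸) Sg]

/-- The letterwise action on the free monoid of words over the alphabet `Sg`. -/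
instance : MulDistribMulAction (FinPerm 𝔸) (FreeMonoid Sg) where
  smul π w := FreeMonoid.map (π • ·) w
  one_smul w := by
    change FreeMonoid.map _ w = w
    simp only [one_smul]
    exact DFunLike.congr_fun FreeMonoid.map_id w
  mul_smul π σ w := by
    change FreeMonoid.map _ w = FreeMonoid.map _ (FreeMonoid.map _ w)
    rw [FreeMonoid.map_map]
    congr 2
    funext x
    exact mul_smul π σ x
  smul_mul π v w := map_mul (FreeMonoid.map _) v w
  smul_one π := map_one (FreeMonoid.map _)

instance [IsNominal 𝔸 Sg] : IsNominal 𝔸 (FreeMonoid Sg) where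
  finSupp w := by
    induction w using FreeMonoid.inductionOn' with
    | one => exact ⟨∅, fun π _ => smul_one π⟩
    | of_mul x w ih =>
      obtain ⟨S, hx, hw⟩ := (IsNominal.finSupp (𝔸 := 𝔸) x).exists_common ih
      refine ⟨S, fun π hπ => ?_⟩
      rw [smul_mul', hw π hπ]
      congr 1
      change FreeMonoid.map _ (FreeMonoid.of x) = _
      rw [FreeMonoid.map_of, hx π hπ]

/-- Equivariant congruences on the free monoid. They represent the surjective equivariant
morphisms from the free monoid to nominal monoids up to isomorphism. -/
structure EqvCon (𝔸 : Type) (Sg : Type u) [MulAction (FinPerm 𝔸) Sg] where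
  con : Con (FreeMonoid Sg)
  equivariant : ∀ (π : FinPerm 𝔸) (v w : FreeMonoid Sg), con v w → con (π • v) (π • w)

/-- The quotient monoid of the free monoid by an equivariant congruence. -/
def EqvCon.Quot (c : EqvCon 𝔸 Sg) : Type u := c.con.Quotient

instance (c : EqvCon 𝔸 Sg) : Monoid c.Quot := inferInstanceAs (Monoid c.con.Quotient)

/-- The canonical quotient morphism. -/
def EqvCon.quotMk (c : EqvCon 𝔸 Sg) : FreeMonoid Sg →* c.Quot := c.con.mk'

theorem EqvCon.quotMk_surjective (c : EqvCon 𝔸 Sg) : Function.Surjective c.quotMk :=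
  Con.mk'_surjective

instance (c : EqvCon 𝔸 Sg) : MulDistribMulAction (FinPerm 𝔸) c.Quot where
  smul π x := c.con.liftOn x (fun w => c.quotMk (π • w))
    fun v w h => (Con.eq c.con).2 (c.equivariant π v w h)
  one_smul x := by
    obtain ⟨w, rfl⟩ := c.quotMk_surjective x
    exact congrArg c.quotMk (one_smul _ w)
  mul_smul π σ x := by
    obtain ⟨w, rfl⟩ := c.quotMk_surjective x
    exact congrArg c.quotMk (mul_smul π σ w)
  smul_mul π x y := by
    obtain ⟨v, rfl⟩ := c.quotMk_surjective x
    obtain ⟨w, rfl⟩ := c.quotMk_surjective y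
    exact (congrArg c.quotMk (smul_mul' π v w)).trans (map_mul c.quotMk _ _)
  smul_one π := congrArg c.quotMk (smul_one π)

theorem EqvCon.quotMk_smul (c : EqvCon 𝔸 Sg) (π : FinPerm 𝔸) (w : FreeMonoid Sg) :
    c.quotMk (π • w) = π • c.quotMk w := rfl

instance [IsNominal 𝔸 Sg] (c : EqvCon 𝔸 Sg) : IsNominal 𝔸 c.Quot where
  finSupp x := by
    obtain ⟨w, rfl⟩ := c.quotMk_surjective x
    obtain ⟨S, hS⟩ := IsNominal.finSupp (𝔸 := 𝔸) w
    exact ⟨S, fun π hπ => by rw [← c.quotMk_smul, hS π hπ]⟩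

/-- The canonical map between the quotients by two congruences, the first of which is
contained in the second. -/
def EqvCon.map (c d : EqvCon 𝔸 Sg) (h : c.con ≤ d.con) : c.Quot →* d.Quot :=
  Con.map c.con d.con h

theorem EqvCon.map_smul (c d : EqvCon 𝔸 Sg) (h : c.con ≤ d.con) (π : FinPerm 𝔸) (x : c.Quot) :
    c.map d h (π • x) = π • c.map d h x := by
  obtain ⟨w, rfl⟩ := c.quotMk_surjective x
  rfl

/-- A support bound: a map assigning to every word a set of names of size at most `k`, for
some `k` independent of the word. -/
structure SupportBound (𝔸 : Type) (Sg : Type u) where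
  toFun : FreeMonoid Sg → Finset 𝔸
  bounded : ∃ k : ℕ, ∀ w, (toFun w).card ≤ k

instance : CoeFun (SupportBound 𝔸 Sg) (fun _ => FreeMonoid Sg → Finset 𝔸) :=
  ⟨SupportBound.toFun⟩

/-- An equivariant `s`-bounded monoid morphism. -/
structure IsBoundedMorphism (s : SupportBound 𝔸 Sg) {M : Type u} [Monoid M]
    [MulDistribMulAction (FinPerm 𝔸) M] (h : FreeMonoid Sg →* M) : Prop where
  equivariant : Equivariant 𝔸 h
  supp_subset : ∀ w, supp 𝔸 (h w) ⊆ s w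

/-- The `s`-bounded orbit-finite quotient monoids of the free monoid. (If all `s w` have at
most `k` elements, then the quotient is automatically `k`-bounded.) -/
structure BoundedQuotient (s : SupportBound 𝔸 Sg) extends EqvCon 𝔸 Sg where
  orbitFinite : OrbitFinite 𝔸 toEqvCon.Quot
  bounded : IsBoundedMorphism s toEqvCon.quotMk

/-- The `s`-bounded pro-orbit-finite words: the limit, in nominal sets, of all `s`-bounded
orbit-finite quotient monoids of the free monoid, ordered by factorization. Its elements are the
finitely supported compatible families. -/
def ProWord (s : SupportBound 𝔸 Sg) : Type u :=
  {x : ∀ q : BoundedQuotient s, q.Quot //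
    (∀ (q r : BoundedQuotient s) (h : q.con ≤ r.con), q.map r.toEqvCon h (x q) = x r) ∧
      FinSupp 𝔸 x}

instance (s : SupportBound 𝔸 Sg) : MulAction (FinPerm 𝔸) (ProWord s) where
  smul π x := ⟨π • x.1, fun q r h => by
    rw [Pi.smul_apply, EqvCon.map_smul, x.2.1 q r h, Pi.smul_apply], x.2.2.smul π⟩
  one_smul x := Subtype.ext (one_smul _ x.1)
  mul_smul π σ x := Subtype.ext (mul_smul π σ x.1)

instance (s : SupportBound 𝔸 Sg) : IsNominal 𝔸 (ProWord s) where
  finSupp x := by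
    obtain ⟨S, hS⟩ := x.2.2
    exact ⟨S, fun π hπ => Subtype.ext (hS π hπ)⟩

/-- The limit projections. -/
def ProWord.proj {s : SupportBound 𝔸 Sg} (q : BoundedQuotient s) (x : ProWord s) : q.Quot :=
  x.1 q

/-- The initial topology with respect to the limit projections to the discrete spaces
`q.Quot`: the open sets are the finitely supported unions of finite intersections of preimages
of points under the projections. (A union of such sets that is itself finitely supported is
automatically the union of a finitely supported family of them, namely of all of them that
are contained in it.) -/
def ProWord.topology (s : SupportBound 𝔸 Sg) : NomTop 𝔸 (ProWord s) where
  IsOpen U := FinSupp 𝔸 U ∧ ∀ x ∈ U, ∃ F : Set (BoundedQuotient s), F.Finite ∧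
    ∀ y : ProWord s, (∀ q ∈ F, y.proj q = x.proj q) → y ∈ U
  finSupp _ h := h.1
  smul π U h := by
    refine ⟨h.1.smul π, fun x hx => ?_⟩
    rw [Set.mem_smul_set_iff_inv_smul_mem] at hx
    obtain ⟨F, hF, hFU⟩ := h.2 _ hx
    refine ⟨F, hF, fun y hy => ?_⟩
    rw [Set.mem_smul_set_iff_inv_smul_mem]
    exact hFU _ fun q hq => congrArg (fun z => π⁻¹ • z) (hy q hq)
  sUnion 𝒰 h𝒰 h := by
    refine ⟨h𝒰.sUnion, ?_⟩
    rintro x ⟨U, hU, hx⟩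
    obtain ⟨F, hF, hFU⟩ := (h U hU).2 x hx
    exact ⟨F, hF, fun y hy => ⟨U, hU, hFU y hy⟩⟩
  univ := ⟨FinSupp.univ, fun _ _ => ⟨∅, Set.finite_empty, fun _ _ => trivial⟩⟩
  inter U V hU hV := by
    refine ⟨hU.1.inter hV.1, ?_⟩
    rintro x ⟨hxU, hxV⟩
    obtain ⟨F, hF, hFU⟩ := hU.2 x hxU
    obtain ⟨G, hG, hGV⟩ := hV.2 x hxV
    exact ⟨F ∪ G, hF.union hG, fun y hy =>
      ⟨hFU y fun q hq => hy q (Or.inl hq), hGV y fun q hq => hy q (Or.inr hq)⟩⟩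

/-- The kernel congruence of an equivariant monoid morphism. -/
def EqvCon.ker {M : Type u} [Monoid M] [MulDistribMulAction (FinPerm 𝔸) M]
    (h : FreeMonoid Sg →* M) (he : Equivariant 𝔸 h) : EqvCon 𝔸 Sg where
  con := Con.ker h
  equivariant π v w hvw := by
    rw [Con.ker_rel] at hvw ⊢
    rw [he, he, hvw]

/-- The injective morphism from the quotient by the kernel of `h` that is induced by `h`. -/
def EqvCon.kerLift {M : Type u} [Monoid M] [MulDistribMulAction (FinPerm 𝔸) M]
    (h : FreeMonoid Sg →* M) (he : Equivariant 𝔸 h) : (EqvCon.ker h he).Quot →* M :=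
  Con.kerLift h

theorem EqvCon.kerLift_injective {M : Type u} [Monoid M] [MulDistribMulAction (FinPerm 𝔸) M]
    (h : FreeMonoid Sg →* M) (he : Equivariant 𝔸 h) :
    Function.Injective (EqvCon.kerLift h he) :=
  Con.kerLift_injective h

theorem EqvCon.kerLift_smul {M : Type u} [Monoid M] [MulDistribMulAction (FinPerm 𝔸) M]
    (h : FreeMonoid Sg →* M) (he : Equivariant 𝔸 h) (π : FinPerm 𝔸)
    (x : (EqvCon.ker h he).Quot) :
    EqvCon.kerLift h he (π • x) = π • EqvCon.kerLift h he x := by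
  obtain ⟨w, rfl⟩ := (EqvCon.ker h he).quotMk_surjective x
  exact he π w

/-- The coimage of an `s`-bounded morphism into an orbit-finite nominal monoid. -/
def BoundedQuotient.coimage {s : SupportBound 𝔸 Sg} {M : Type u} [Monoid M]
    [MulDistribMulAction (FinPerm 𝔸) M] (hM : OrbitFinite 𝔸 M) (h : FreeMonoid Sg →* M)
    (hh : IsBoundedMorphism s h) : BoundedQuotient s where
  toEqvCon := EqvCon.ker h hh.equivariant
  orbitFinite := by
    have : Finite (MulAction.orbitRel.Quotient (FinPerm 𝔸) M) := hM
    refine Finite.of_injective (β := MulAction.orbitRel.Quotient (FinPerm 𝔸) M)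
      (Quotient.map' (EqvCon.kerLift h hh.equivariant) ?_) ?_
    · rintro _ y ⟨π, rfl⟩
      exact ⟨π, (EqvCon.kerLift_smul h hh.equivariant π y).symm⟩
    · intro a b
      induction a using Quotient.inductionOn'
      induction b using Quotient.inductionOn'
      intro hab
      obtain ⟨π, hπ⟩ := Quotient.exact' hab
      refine Quotient.sound' ⟨π, EqvCon.kerLift_injective h hh.equivariant ?_⟩
      rw [← hπ, EqvCon.kerLift_smul]
  bounded :=
    { equivariant := fun _ _ => rfl
      supp_subset := fun w a ha => hh.supp_subset w fun S hS => ha S fun π hπ => by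
        refine EqvCon.kerLift_injective h hh.equivariant ?_
        rw [EqvCon.kerLift_smul]
        exact hS π hπ }

/-- The limit projection `ĥ` associated to an `s`-bounded morphism `h` into an orbit-finite
nominal monoid `M`: the projection to the coimage of `h`, followed by the inclusion into `M`. -/
def ProWord.extend {s : SupportBound 𝔸 Sg} {M : Type u} [Monoid M]
    [MulDistribMulAction (FinPerm 𝔸) M] (hM : OrbitFinite 𝔸 M) (h : FreeMonoid Sg →* M)
    (hh : IsBoundedMorphism s h) (x : ProWord s) : M :=
  EqvCon.kerLift h hh.equivariant (x.proj (BoundedQuotient.coimage hM h hh))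

end ProWords

/-! ### Morphic proequations -/

section Proequations

/-- A morphic pro-orbit-finite equation: a surjective morphism of nominal Stone spaces from the
space of `s`-bounded pro-orbit-finite words over a strong orbit-finite alphabet, for some
support bound `s`. -/
structure MorphicProequation (𝔸 : Type) : Type (u + 1) where
  Alphabet : Type u
  [alphabetAction : MulAction (FinPerm 𝔸) Alphabet]
  [alphabetNominal : IsNominal 𝔸 Alphabet]
  alphabet_orbitFinite : OrbitFinite 𝔸 Alphabet
  alphabet_strong : IsStrong 𝔸 Alphabet
  bound : SupportBound 𝔸 Alphabet
  Codomain : Type u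
  [codomainAction : MulAction (FinPerm 𝔸) Codomain]
  [codomainNominal : IsNominal 𝔸 Codomain]
  topology : NomTop 𝔸 Codomain
  isStone : topology.IsStone
  map : ProWord bound → Codomain
  isMorphism : IsMorphism (ProWord.topology bound) topology map
  surjective : Function.Surjective map

variable {𝔸 : Type}

instance (φ : MorphicProequation.{u} 𝔸) : MulAction (FinPerm 𝔸) φ.Alphabet := φ.alphabetAction
instance (φ : MorphicProequation.{u} 𝔸) : IsNominal 𝔸 φ.Alphabet := φ.alphabetNominal
instance (φ : MorphicProequation.{u} 𝔸) : MulAction (FinPerm 𝔸) φ.Codomain := φ.codomainAction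
instance (φ : MorphicProequation.{u} 𝔸) : IsNominal 𝔸 φ.Codomain := φ.codomainNominal

/-- The orbit-finite nominal monoid `M` satisfies `φ` if for every `s`-bounded morphism `h` into
`M` the limit projection `ĥ` factorizes through `φ` in the category of `k`-bounded nominal Stone
spaces, where `M` is considered as a discrete space and `k` bounds the supports of `M` and
the support bound `s`. -/
def Satisfies (M : NomMon.{u} 𝔸) (hM : OrbitFinite 𝔸 M) (φ : MorphicProequation.{u} 𝔸) : Prop :=
  ∀ (h : FreeMonoid φ.Alphabet →* M) (hh : IsBoundedMorphism φ.bound h),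
    ∃ k : ℕ, IsBounded 𝔸 k M ∧ (∀ w, (φ.bound w).card ≤ k) ∧ IsBounded 𝔸 k φ.Codomain ∧
      ∃ g : φ.Codomain → M, IsMorphism φ.topology (NomTop.discrete 𝔸 M) g ∧
        ∀ x : ProWord φ.bound, ProWord.extend hM h hh x = g (φ.map x)

/-- A class of nominal monoids is presentable by morphic proequations if, for some set (as
opposed to a proper class) of morphic proequations, it consists of all orbit-finite nominal
monoids that satisfy all proequations of this set. -/
def IsPresentable (𝒱 : Set (NomMon.{u} 𝔸)) : Prop :=
  ∃ T : Set (MorphicProequation.{u} 𝔸), Small.{u} T ∧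
    ∀ M : NomMon.{u} 𝔸, M ∈ 𝒱 ↔ ∃ hM : OrbitFinite 𝔸 M, ∀ φ ∈ T, Satisfies M hM φ

end Proequations

end Nominal

/-! Both directions rest on matching the support bound `s` with support-reflecting maps.

From a pseudovariety to proequations: for fixed `s`, the `s`-bounded quotients of the free monoid
that lie in `𝒱` are codirected, because the coimage of the tuple of finitely many quotient maps
refines all of them. Restricting pro-orbit-finite words to these quotients gives the proequation
`IsMSRPseudovariety.proequation`. Its codomain `ProImage` is the set of tuples that actually occur,
so surjectivity is immediate and the work lies in `ProImage.isStone`. Members of `𝒱` satisfy it,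
since the coimage of `h` lies in `𝒱` and `ĥ` is therefore essentially one of the projections.
Conversely, let `M` satisfy all these proequations. Cover `M` by `H : Σ* → M` over a strong alphabet
and take the tightest bound, `s w = supp (H w)`. By compactness the factor of `Ĥ` depends on a
single projection (`ProImage.exists_factor`), so `H` factorizes through an `s`-bounded quotient `q`
in `𝒱`. The image of `w` in `q` has support inside `s w = supp (H w)`, so the induced map from `q`
to `M` preserves supports and is an MSR quotient.

From proequations to a pseudovariety: factorizations are tupled for products and corestricted for
submonoids. For an MSR quotient `e : M → N`, strength of the alphabet lets a morphism into `N` be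
lifted letterwise into the submonoid on which `e` preserves supports; the lift is thus still
`s`-bounded.

Compactness reduces to finite sets: elements of a `k`-bounded nominal set can be moved, fixing `S`,
until they are supported by `S` plus `k` further names, and an orbit-finite set has only finitely
many elements with a given support. -/

namespace Nominal

/-! ### Finite permutations -/

section FinPerm

variable {𝔸 : Type}

/-- The transposition of two names. -/
def FinPerm.swap [DecidableEq 𝔸] (a b : 𝔸) : FinPerm 𝔸 :=
  ⟨Equiv.swap a b, (Set.toFinite {a, b}).subset fun c hc => by
    by_contra hcon
    simp only [Set.mem_insert_iff, Set.mem_singleton_iff, not_or] at hcon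
    exact hc (Equiv.swap_apply_of_ne_of_ne hcon.1 hcon.2)⟩

theorem FinPerm.swap_smul_left [DecidableEq 𝔸] (a b : 𝔸) : FinPerm.swap a b • a = b :=
  Equiv.swap_apply_left a b

theorem FinPerm.swap_smul_right [DecidableEq 𝔸] (a b : 𝔸) : FinPerm.swap a b • b = a :=
  Equiv.swap_apply_right a b

theorem FinPerm.swap_smul_of_ne [DecidableEq 𝔸] {a b c : 𝔸} (ha : c ≠ a) (hb : c ≠ b) :
    FinPerm.swap a b • c = c :=
  Equiv.swap_apply_of_ne_of_ne ha hb

theorem FinPerm.ext {π σ : FinPerm 𝔸} (h : ∀ a : 𝔸, π • a = σ • a) : π = σ :=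
  Subtype.ext (Equiv.ext h)

/-- Every injection of a finite set of names extends to a finite permutation. -/
theorem exists_finPerm_eqOn (B : Finset 𝔸) (f : 𝔸 → 𝔸) (hf : Set.InjOn f B) :
    ∃ π : FinPerm 𝔸, ∀ b ∈ B, π • b = f b := by
  classical
  induction B using Finset.induction_on with
  | empty => exact ⟨1, by simp⟩
  | insert b B hb ih =>
    obtain ⟨π, hπ⟩ := ih (hf.mono (by simp))
    -- The transposition corrects the value at `b`; by injectivity of `π` and `f` it does not
    -- disturb the values that are already right.
    refine ⟨FinPerm.swap (π • b) (f b) * π, fun c hc => ?_⟩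
    rw [mul_smul]
    rcases Finset.mem_insert.1 hc with rfl | hcB
    · exact FinPerm.swap_smul_left _ _
    · have hcb : c ≠ b := fun h => hb (h ▸ hcB)
      rw [FinPerm.swap_smul_of_ne, hπ c hcB]
      · exact fun h => hcb (MulAction.injective π h)
      · rw [hπ c hcB]
        exact fun h => hcb (hf (by simpa using hc) (by simp) h)

/-- If `T ⊇ S` is large enough, then a finite set `B` can be moved into `T` by a finite
permutation that fixes `S` pointwise. -/
theorem exists_finPerm_mapsTo {S T : Finset 𝔸} (hST : S ⊆ T) (B : Finset 𝔸)
    (h : S.card + B.card ≤ T.card) :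
    ∃ π : FinPerm 𝔸, (∀ a ∈ S, π • a = a) ∧ ∀ a ∈ B, π • a ∈ T := by
  classical
  have hcard : Fintype.card ↥(B \ S) ≤ Fintype.card ↥(T \ S) := by
    rw [Fintype.card_coe, Fintype.card_coe]
    have h1 := Finset.card_sdiff_add_card_eq_card hST
    have h2 := Finset.card_le_card (Finset.sdiff_subset (s := B) (t := S))
    omega
  obtain ⟨g⟩ := Function.Embedding.nonempty_of_card_le hcard
  have hg : ∀ a, (g a : 𝔸) ∈ T ∧ (g a : 𝔸) ∉ S := fun a => Finset.mem_sdiff.1 (g a).2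
  let f : 𝔸 → 𝔸 := fun a => if ha : a ∈ B \ S then g ⟨a, ha⟩ else a
  have hfS : ∀ a ∈ S, f a = a := fun a ha => dif_neg (by simp [ha])
  have hfB : ∀ a (ha : a ∈ B \ S), f a = g ⟨a, ha⟩ := fun a ha => dif_pos ha
  have hmem : ∀ a ∈ S ∪ B, a ∈ S ∨ a ∈ B \ S := by
    intro a ha
    by_cases haS : a ∈ S
    · exact Or.inl haS
    · exact Or.inr (by simp_all)
  obtain ⟨π, hπ⟩ := exists_finPerm_eqOn (S ∪ B) f (by
    intro a ha b hb hab
    rcases hmem a ha with h1 | h1 <;> rcases hmem b hb with h2 | h2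
    · rwa [hfS a h1, hfS b h2] at hab
    · rw [hfS a h1, hfB b h2] at hab
      exact absurd (hab ▸ h1) (hg _).2
    · rw [hfB a h1, hfS b h2] at hab
      exact absurd (hab ▸ h2) (hg _).2
    · rw [hfB a h1, hfB b h2] at hab
      exact congrArg Subtype.val (g.injective (Subtype.ext hab)))
  refine ⟨π, fun a ha => ?_, fun a ha => ?_⟩
  · rw [hπ a (Finset.mem_union_left _ ha), hfS a ha]
  · rw [hπ a (Finset.mem_union_right _ ha)]
    rcases hmem a (Finset.mem_union_right _ ha) with h1 | h1
    · rw [hfS a h1]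
      exact hST h1
    · rw [hfB a h1]
      exact (hg _).1

theorem exists_superset_card [Infinite 𝔸] (S : Finset 𝔸) (k : ℕ) :
    ∃ T : Finset 𝔸, S ⊆ T ∧ T.card = S.card + k :=
  Infinite.exists_superset_card_eq S _ (Nat.le_add_right _ _)

end FinPerm

/-! ### Least supports -/

section Supports

variable {𝔸 : Type} {X Y : Type u} [MulAction (FinPerm 𝔸) X] [MulAction (FinPerm 𝔸) Y]

theorem smul_eq_smul_of_supports {B : Set 𝔸} {x : X} (h : MulAction.Supports (FinPerm 𝔸) B x)
    {π σ : FinPerm 𝔸} (hπσ : ∀ a ∈ B, π • a = σ • a) : π • x = σ • x := by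
  have : (σ⁻¹ * π) • x = x := h _ fun a ha => by rw [mul_smul, hπσ a ha, inv_smul_smul]
  rwa [mul_smul, inv_smul_eq_iff] at this

theorem supports_smul {B : Set 𝔸} {x : X} (h : MulAction.Supports (FinPerm 𝔸) B x)
    (π : FinPerm 𝔸) : MulAction.Supports (FinPerm 𝔸) (π • B) (π • x) := by
  intro σ hσ
  rw [← mul_smul]
  refine smul_eq_smul_of_supports h fun a ha => ?_
  rw [mul_smul, hσ (Set.smul_mem_smul_set ha)]

theorem Equivariant.supports {f : X → Y} (hf : Equivariant 𝔸 f) {B : Set 𝔸} {x : X}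
    (h : MulAction.Supports (FinPerm 𝔸) B x) : MulAction.Supports (FinPerm 𝔸) B (f x) :=
  fun π hπ => by rw [← hf, h π hπ]

/-- Induction on the number of names moved by `π`: if `π` moves `a`, composing it with the
transposition of `a` and `π • a` makes `a` fixed and moves no new name. -/
theorem supports_of_swap [DecidableEq 𝔸] {B : Set 𝔸} {x : X}
    (h : ∀ a ∉ B, ∀ b ∉ B, FinPerm.swap a b • x = x) :
    MulAction.Supports (FinPerm 𝔸) B x := by
  intro π hπ
  induction hn : {a : 𝔸 | π • a ≠ a}.ncard using Nat.strong_induction_on generalizing π with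
  | _ n ih =>
  by_cases h1 : ∀ a : 𝔸, π • a = a
  · have : π = 1 := FinPerm.ext fun a => by rw [h1, one_smul]
    rw [this, one_smul]
  · push Not at h1
    obtain ⟨a, ha⟩ := h1
    have hπa : π • π • a ≠ π • a := fun hb => ha (MulAction.injective π hb)
    have haB : a ∉ B := fun hb => ha (hπ hb)
    have hπaB : π • a ∉ B := fun hb => hπa (hπ hb)
    have hfix : ∀ b : 𝔸, π • b = b → (FinPerm.swap a (π • a) * π) • b = b := by
      intro b hb
      rw [mul_smul, hb, FinPerm.swap_smul_of_ne]
      · rintro rfl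
        exact ha hb
      · rintro rfl
        exact hπa hb
    have hsw := h a haB _ hπaB
    have key : (FinPerm.swap a (π • a) * π) • x = x := by
      refine ih _ ?_ _ (fun b hb => hfix b (hπ hb)) rfl
      rw [← hn]
      refine Set.ncard_lt_ncard ⟨fun b hb hcon => hb (hfix b hcon), fun hcon => ?_⟩ π.2
      exact hcon (a := a) ha (by rw [mul_smul, FinPerm.swap_smul_right])
    rw [mul_smul, ← eq_inv_smul_iff] at key
    rw [key, inv_smul_eq_iff, hsw]

/-- This is why least supports exist. For `c` outside `S ∪ T`, the transposition of `c` with a name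
outside `S ∩ T` avoids `S` or avoids `T`, so it fixes `x`. Any transposition `(a b)` avoiding `S ∩
T` equals `(a c)(b c)(a c)` for such a fresh `c`. -/
theorem supports_inter [Infinite 𝔸] [DecidableEq 𝔸] {x : X} {S T : Finset 𝔸}
    (hS : MulAction.Supports (FinPerm 𝔸) (S : Set 𝔸) x)
    (hT : MulAction.Supports (FinPerm 𝔸) (T : Set 𝔸) x) :
    MulAction.Supports (FinPerm 𝔸) ((S ∩ T : Finset 𝔸) : Set 𝔸) x := by
  have fresh : ∀ a c, a ∉ S ∩ T → c ∉ S ∪ T → FinPerm.swap a c • x = x := by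
    intro a c ha hc
    rw [Finset.mem_union, not_or] at hc
    by_cases haS : a ∈ S
    · have haT : a ∉ T := fun h => ha (Finset.mem_inter.2 ⟨haS, h⟩)
      exact hT _ fun b hb => FinPerm.swap_smul_of_ne (fun h => haT (h ▸ hb)) fun h => hc.2 (h ▸ hb)
    · exact hS _ fun b hb => FinPerm.swap_smul_of_ne (fun h => haS (h ▸ hb)) fun h => hc.1 (h ▸ hb)
  refine supports_of_swap fun a ha b hb => ?_
  obtain ⟨c, hc⟩ := Infinite.exists_notMem_finset (S ∪ T ∪ {a, b})
  simp only [Finset.mem_union, Finset.mem_insert, Finset.mem_singleton, not_or] at hc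
  have hcST : c ∉ S ∪ T := by simpa using hc.1
  by_cases hab : a = b
  · subst hab
    exact (congrArg (· • x) (FinPerm.ext fun d => by
      rw [one_smul]
      exact congrArg (· d) (Equiv.swap_self a))).trans (one_smul _ x)
  · have : FinPerm.swap a b = FinPerm.swap a c * FinPerm.swap b c * FinPerm.swap a c :=
      Subtype.ext (by
        have := Equiv.swap_mul_swap_mul_swap (x := b) (y := c) (z := a) (Ne.symm hc.2.2) (Ne.symm hab)
        rw [Equiv.swap_comm c a] at this
        exact this.symm)
    rw [this, mul_smul, mul_smul, fresh a c ha hcST, fresh b c hb hcST, fresh a c ha hcST]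

theorem FinSupp.exists_finset [Infinite 𝔸] {x : X} (hx : FinSupp 𝔸 x) :
    ∃ S : Finset 𝔸, (S : Set 𝔸) = supp 𝔸 x ∧ MulAction.Supports (FinPerm 𝔸) (S : Set 𝔸) x := by
  classical
  obtain ⟨S, hS, hmin⟩ := exists_minimal_of_wellFoundedLT
    (fun S : Finset 𝔸 => MulAction.Supports (FinPerm 𝔸) (S : Set 𝔸) x) hx
  refine ⟨S, Set.Subset.antisymm (fun a ha T hT => ?_) fun a ha => ha S hS, hS⟩
  exact Finset.inter_subset_right (hmin (supports_inter hS hT) Finset.inter_subset_left ha)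

theorem FinSupp.supports_supp [Infinite 𝔸] {x : X} (hx : FinSupp 𝔸 x) :
    MulAction.Supports (FinPerm 𝔸) (supp 𝔸 x) x := by
  obtain ⟨S, hS, h⟩ := hx.exists_finset
  rwa [hS] at h

theorem FinSupp.finite_supp {x : X} (hx : FinSupp 𝔸 x) : (supp 𝔸 x).Finite := by
  obtain ⟨S, hS⟩ := hx
  exact S.finite_toSet.subset fun a ha => ha S hS

theorem supp_subset {x : X} {B : Set 𝔸} (hB : B.Finite)
    (h : MulAction.Supports (FinPerm 𝔸) B x) : supp 𝔸 x ⊆ B := by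
  intro a ha
  have := ha hB.toFinset (by simpa using h)
  simpa using this

theorem supports_of_supp_subset [Infinite 𝔸] {x : X} (hx : FinSupp 𝔸 x) {B : Set 𝔸}
    (h : supp 𝔸 x ⊆ B) : MulAction.Supports (FinPerm 𝔸) B x :=
  hx.supports_supp.mono h

theorem Equivariant.supp_subset {f : X → Y} (hf : Equivariant 𝔸 f) (x : X) :
    supp 𝔸 (f x) ⊆ supp 𝔸 x :=
  fun _ ha S hS => ha S (hf.supports hS)

theorem Equivariant.supp_eq {f : X → Y} (hf : Equivariant 𝔸 f) (hinj : Function.Injective f)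
    (x : X) : supp 𝔸 (f x) = supp 𝔸 x :=
  (hf.supp_subset x).antisymm fun _ ha S hS => ha S fun π hπ => hinj (by rw [hf, hS π hπ])

theorem supp_smul_subset [Infinite 𝔸] {x : X} (hx : FinSupp 𝔸 x) (π : FinPerm 𝔸) :
    supp 𝔸 (π • x) ⊆ π • supp 𝔸 x :=
  Nominal.supp_subset (hx.finite_supp.smul_set) (supports_smul hx.supports_supp π)

theorem smul_mem_supp [Infinite 𝔸] {x : X} (hx : FinSupp 𝔸 x) (π : FinPerm 𝔸) {a : 𝔸}
    (ha : a ∈ supp 𝔸 x) : π • a ∈ supp 𝔸 (π • x) := by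
  have := supp_smul_subset (hx.smul π) π⁻¹ (a := a) (by rwa [inv_smul_smul])
  rwa [Set.mem_smul_set_iff_inv_smul_mem, inv_inv] at this

theorem supp_smul [Infinite 𝔸] {x : X} (hx : FinSupp 𝔸 x) (π : FinPerm 𝔸) :
    supp 𝔸 (π • x) = π • supp 𝔸 x := by
  refine (supp_smul_subset hx π).antisymm ?_
  rintro _ ⟨a, ha, rfl⟩
  exact smul_mem_supp hx π ha

end Supports

/-! ### Orbit-finite nominal sets -/

section OrbitFinite

variable {𝔸 : Type} {X Y : Type u} [MulAction (FinPerm 𝔸) X] [MulAction (FinPerm 𝔸) Y]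

theorem OrbitFinite.of_surjective (hX : OrbitFinite 𝔸 X) {f : X → Y} (hf : Equivariant 𝔸 f)
    (hsurj : Function.Surjective f) : OrbitFinite 𝔸 Y := by
  have : Finite (MulAction.orbitRel.Quotient (FinPerm 𝔸) X) := hX
  refine Finite.of_surjective (α := MulAction.orbitRel.Quotient (FinPerm 𝔸) X)
    (Quotient.map' f ?_) ?_
  · rintro _ y ⟨π, rfl⟩
    exact ⟨π, (hf π y).symm⟩
  · intro b
    induction b using Quotient.inductionOn' with | _ b
    obtain ⟨a, rfl⟩ := hsurj b
    exact ⟨Quotient.mk'' a, rfl⟩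

theorem OrbitFinite.of_injective (hY : OrbitFinite 𝔸 Y) {f : X → Y} (hf : Equivariant 𝔸 f)
    (hinj : Function.Injective f) : OrbitFinite 𝔸 X := by
  have : Finite (MulAction.orbitRel.Quotient (FinPerm 𝔸) Y) := hY
  refine Finite.of_injective (β := MulAction.orbitRel.Quotient (FinPerm 𝔸) Y)
    (Quotient.map' f ?_) ?_
  · rintro _ y ⟨π, rfl⟩
    exact ⟨π, (hf π y).symm⟩
  · intro a b
    induction a using Quotient.inductionOn' with | _ a
    induction b using Quotient.inductionOn' with | _ b
    intro hab
    obtain ⟨π, hπ⟩ := Quotient.exact' hab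
    exact Quotient.sound' ⟨π, hinj (by rw [← hπ]; exact hf π b)⟩

theorem OrbitFinite.exists_finite_reps (hX : OrbitFinite 𝔸 X) :
    ∃ R : Set X, R.Finite ∧ ∀ x, ∃ r ∈ R, ∃ π : FinPerm 𝔸, π • r = x := by
  have : Finite (MulAction.orbitRel.Quotient (FinPerm 𝔸) X) := hX
  refine ⟨_, Set.finite_range
    (Quotient.out : MulAction.orbitRel.Quotient (FinPerm 𝔸) X → X), fun x => ?_⟩
  refine ⟨_, ⟨Quotient.mk'' x, rfl⟩, ?_⟩
  obtain ⟨π, hπ⟩ := (MulAction.orbitRel (FinPerm 𝔸) X).symm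
    (Quotient.mk_out (s := MulAction.orbitRel (FinPerm 𝔸) X) x)
  exact ⟨π, hπ⟩

theorem OrbitFinite.of_finite_reps {R : Set X} (hR : R.Finite)
    (h : ∀ x, ∃ r ∈ R, ∃ π : FinPerm 𝔸, π • r = x) : OrbitFinite 𝔸 X := by
  have := hR.to_subtype
  refine Finite.of_surjective (fun r : R => (Quotient.mk'' (r : X) :
    MulAction.orbitRel.Quotient (FinPerm 𝔸) X)) fun b => ?_
  induction b using Quotient.inductionOn' with | _ b
  obtain ⟨r, hr, π, rfl⟩ := h b
  exact ⟨⟨r, hr⟩, Quotient.sound' ((MulAction.orbitRel (FinPerm 𝔸) X).symm ⟨π, rfl⟩)⟩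

theorem IsBounded.mono {k l : ℕ} (hkl : k ≤ l) (h : IsBounded 𝔸 k X) : IsBounded 𝔸 l X :=
  fun x => (h x).trans (by exact_mod_cast hkl)

theorem IsBounded.of_surjective {k : ℕ} (hX : IsBounded 𝔸 k X) {f : X → Y}
    (hf : Equivariant 𝔸 f) (hsurj : Function.Surjective f) : IsBounded 𝔸 k Y := by
  intro y
  obtain ⟨x, rfl⟩ := hsurj y
  exact (Set.encard_le_encard (hf.supp_subset x)).trans (hX x)

theorem OrbitFinite.exists_isBounded [Infinite 𝔸] [IsNominal 𝔸 X] (hX : OrbitFinite 𝔸 X) :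
    ∃ k, IsBounded 𝔸 k X := by
  obtain ⟨R, hR, hrep⟩ := hX.exists_finite_reps
  obtain ⟨k, hk⟩ := (hR.image fun x => (supp 𝔸 x).ncard).bddAbove
  refine ⟨k, fun x => ?_⟩
  obtain ⟨r, hr, π, rfl⟩ := hrep x
  have hfin := IsNominal.finSupp (𝔸 := 𝔸) r
  rw [supp_smul hfin, ← Set.image_smul, (MulAction.injective π).encard_image,
    ← hfin.finite_supp.cast_ncard_eq]
  exact_mod_cast hk ⟨r, hr, rfl⟩

/-- In an orbit-finite nominal set, only finitely many elements are supported by a given finite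
set. -/
theorem OrbitFinite.finite_supported [Infinite 𝔸] [IsNominal 𝔸 X] (hX : OrbitFinite 𝔸 X)
    (T : Finset 𝔸) : {x : X | MulAction.Supports (FinPerm 𝔸) (T : Set 𝔸) x}.Finite := by
  obtain ⟨R, hR, hrep⟩ := hX.exists_finite_reps
  refine (hR.biUnion (t := fun r => {x : X | MulAction.Supports (FinPerm 𝔸) (T : Set 𝔸) x ∧
    ∃ π : FinPerm 𝔸, π • r = x}) fun r _ => ?_).subset fun x hx => ?_
  · have hr := IsNominal.finSupp (𝔸 := 𝔸) r
    have := hr.finite_supp.to_subtype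
    -- Code `x` by the set of restrictions to `supp r` of the permutations carrying `r` to `x`.
    -- There are finitely many codes, and a shared restriction already forces two elements to
    -- coincide because `supp r` supports `r`.
    refine Set.Finite.of_finite_image
      (f := fun x => {f : supp 𝔸 r → T | ∃ π : FinPerm 𝔸, π • r = x ∧ ∀ a : supp 𝔸 r, π • (a : 𝔸) = f a})
      (Set.toFinite _) ?_
    rintro _ ⟨hT, π, rfl⟩ y - hxy
    have hmem : ∀ a : supp 𝔸 r, π • (a : 𝔸) ∈ T := fun a =>
      supp_subset T.finite_toSet hT (smul_mem_supp hr π a.2)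
    have hπ : (fun a : supp 𝔸 r => (⟨π • (a : 𝔸), hmem a⟩ : T)) ∈ {f : supp 𝔸 r → T | ∃ σ : FinPerm 𝔸,
      σ • r = π • r ∧ ∀ a : supp 𝔸 r, σ • (a : 𝔸) = f a} := ⟨π, rfl, fun _ => rfl⟩
    dsimp only at hxy
    rw [hxy] at hπ
    obtain ⟨σ, hσ, h⟩ := hπ
    rw [← hσ]
    exact smul_eq_smul_of_supports hr.supports_supp fun a ha => (h ⟨a, ha⟩).symm
  · obtain ⟨r, hr, h⟩ := hrep x
    exact Set.mem_biUnion hr ⟨hx, h⟩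

/-- Every support has at most `k` names and fits into a fixed set `T` of `k` names, so the
`T`-supported elements meet every orbit. -/
theorem OrbitFinite.of_finite_supported [Infinite 𝔸] [IsNominal 𝔸 X] {k : ℕ}
    (hk : IsBounded 𝔸 k X)
    (h : ∀ T : Finset 𝔸, {x : X | MulAction.Supports (FinPerm 𝔸) (T : Set 𝔸) x}.Finite) :
    OrbitFinite 𝔸 X := by
  obtain ⟨T, -, hT⟩ := exists_superset_card (∅ : Finset 𝔸) k
  refine OrbitFinite.of_finite_reps (h T) fun x => ?_
  obtain ⟨S, hS, hSx⟩ := (IsNominal.finSupp (𝔸 := 𝔸) x).exists_finset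
  obtain ⟨π, -, hπ⟩ := exists_finPerm_mapsTo (Finset.empty_subset T) S (by
    have := hk x
    rw [← hS, Set.encard_coe_eq_coe_finsetCard] at this
    have : S.card ≤ k := by exact_mod_cast this
    omega)
  refine ⟨π • x, (supports_smul hSx π).mono ?_, π⁻¹, inv_smul_smul _ _⟩
  rintro _ ⟨a, ha, rfl⟩
  exact hπ a ha

theorem supp_pi_subset [Infinite 𝔸] {ι : Type} [Finite ι] {Z : ι → Type u}
    [∀ i, MulAction (FinPerm 𝔸) (Z i)] [∀ i, IsNominal 𝔸 (Z i)] (x : ∀ i, Z i) :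
    supp 𝔸 x ⊆ ⋃ i, supp 𝔸 (x i) := by
  refine Nominal.supp_subset (Set.finite_iUnion fun i => (IsNominal.finSupp (x i)).finite_supp)
    fun π hπ => funext fun i => ?_
  exact (IsNominal.finSupp (x i)).supports_supp π fun a ha => hπ (Set.mem_iUnion.2 ⟨i, ha⟩)

/-- Orbits of a product are not products of orbits, hence the detour through supports: a
`T`-supported tuple has `T`-supported components. -/
theorem OrbitFinite.pi [Infinite 𝔸] {n : ℕ} {Z : Fin n → Type u}
    [∀ i, MulAction (FinPerm 𝔸) (Z i)] [∀ i, IsNominal 𝔸 (Z i)] [IsNominal 𝔸 (∀ i, Z i)]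
    (h : ∀ i, OrbitFinite 𝔸 (Z i)) : OrbitFinite 𝔸 (∀ i, Z i) := by
  choose k hk using fun i => (h i).exists_isBounded
  refine OrbitFinite.of_finite_supported (k := ∑ i, k i) (fun x => ?_) fun T => ?_
  · have hle : ∀ i, (supp 𝔸 (x i)).ncard ≤ k i := fun i => by
      have := hk i (x i)
      rw [← (IsNominal.finSupp (x i)).finite_supp.cast_ncard_eq] at this
      exact_mod_cast this
    refine (Set.encard_le_encard (supp_pi_subset x)).trans ?_
    rw [← (Set.finite_iUnion fun i =>
      (IsNominal.finSupp (𝔸 := 𝔸) (x i)).finite_supp).cast_ncard_eq]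
    exact_mod_cast (Set.ncard_iUnion_le_of_fintype _).trans (Finset.sum_le_sum fun i _ => hle i)
  · refine (Set.Finite.pi' fun i => (h i).finite_supported T).subset fun x hx i π hπ => ?_
    exact congrFun (hx π hπ) i

end OrbitFinite

/-- Equivariant relations that contain, for each element of a strong nominal set, a related
element with smaller support, contain an equivariant map. -/
theorem IsStrong.exists_equivariant {𝔸 : Type} [Infinite 𝔸] {X Y : Type u}
    [MulAction (FinPerm 𝔸) X] [MulAction (FinPerm 𝔸) Y] [IsNominal 𝔸 Y] (hX : IsStrong 𝔸 X)
    (R : X → Y → Prop) (hR : ∀ (π : FinPerm 𝔸) x y, R x y → R (π • x) (π • y))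
    (h : ∀ x, ∃ y, R x y ∧ supp 𝔸 y ⊆ supp 𝔸 x) :
    ∃ f : X → Y, Equivariant 𝔸 f ∧ ∀ x, R x (f x) := by
  choose y hy hsupp using h
  let r : X → X := fun x => (Quotient.mk'' x : MulAction.orbitRel.Quotient (FinPerm 𝔸) X).out
  have hr : ∀ x, ∃ π : FinPerm 𝔸, π • r x = x := fun x => by
    obtain ⟨π, hπ⟩ := (MulAction.orbitRel (FinPerm 𝔸) X).symm
      (Quotient.mk_out (s := MulAction.orbitRel (FinPerm 𝔸) X) x)
    exact ⟨π, hπ⟩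
  have hrsmul : ∀ (π : FinPerm 𝔸) x, r (π • x) = r x := fun π x =>
    congrArg Quotient.out (Quotient.sound' ⟨π, rfl⟩)
  choose p hp using hr
  -- The value at the orbit representative `r x` is transported along `p x`. Two permutations
  -- carrying `r x` to the same point differ by a stabilizer of `r x`; by strength it fixes `supp (r
  -- x)` pointwise, hence also the smaller `supp (y (r x))`.
  refine ⟨fun x => p x • y (r x), fun π x => ?_, fun x => ?_⟩
  · simp only [hrsmul]
    rw [← mul_smul]
    refine smul_eq_smul_of_supports ((IsNominal.finSupp (y (r x))).supports_supp) fun a ha => ?_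
    have h1 : ((π * p x)⁻¹ * p (π • x)) • r x = r x := by
      rw [mul_smul, inv_smul_eq_iff, mul_smul, hp x]
      conv_lhs => rw [← hrsmul π x]
      exact hp _
    have h2 := (hX _ _).1 h1 a (hsupp _ ha)
    rwa [mul_smul, inv_smul_eq_iff] at h2
  · have := hR (p x) _ _ (hy (r x))
    rwa [hp] at this

/-! ### Closure properties of orbit-finite nominal monoids -/

section Monoids

variable {𝔸 : Type}

theorem NomMon.orbitFinite_prod [Infinite 𝔸] {n : ℕ} {M : Fin n → NomMon.{u} 𝔸}
    (h : ∀ i, OrbitFinite 𝔸 (M i)) : OrbitFinite 𝔸 (NomMon.prod M) :=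
  have : IsNominal 𝔸 (∀ i, M i) := (NomMon.prod M).nominal
  OrbitFinite.pi (Z := fun i => M i) h

/-- The inclusion of a nominal submonoid. -/
def NomMon.subtype (M : NomMon.{u} 𝔸) (N : Submonoid M) (hN : IsNominalSubmonoid M N) :
    M.sub N hN →* M :=
  N.subtype

theorem NomMon.subtype_equivariant (M : NomMon.{u} 𝔸) (N : Submonoid M)
    (hN : IsNominalSubmonoid M N) : Equivariant 𝔸 (M.subtype N hN) :=
  fun _ _ => rfl

theorem NomMon.subtype_injective (M : NomMon.{u} 𝔸) (N : Submonoid M)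
    (hN : IsNominalSubmonoid M N) : Function.Injective (M.subtype N hN) :=
  Subtype.val_injective

theorem isMSRPseudovariety_orbitFinite [Infinite 𝔸] :
    IsMSRPseudovariety {M : NomMon.{u} 𝔸 | OrbitFinite 𝔸 M} where
  orbitFinite _ hM := hM
  prod _ _ hM := NomMon.orbitFinite_prod hM
  sub M hM N hN := OrbitFinite.of_injective hM (M.subtype_equivariant N hN)
    (M.subtype_injective N hN)
  quotient _ hM _ _ he := OrbitFinite.of_surjective hM he.equivariant he.surjective

theorem IsMSRPseudovariety.of_surjective {𝒱 : Set (NomMon.{u} 𝔸)} (h𝒱 : IsMSRPseudovariety 𝒱)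
    {M N : NomMon.{u} 𝔸} (hM : M ∈ 𝒱) {e : M →* N} (he : Equivariant 𝔸 e)
    (hsurj : Function.Surjective e) (hsupp : ∀ x, supp 𝔸 x ⊆ supp 𝔸 (e x)) : N ∈ 𝒱 :=
  h𝒱.quotient M hM N e ⟨he, hsurj, ⊤, fun _ _ _ => trivial,
    fun y => (hsurj y).imp fun _ hx => ⟨trivial, hx⟩,
    fun x _ => (he.supp_subset x).antisymm (hsupp x)⟩

/-- Closure under submonoids only yields the range of `f`; the isomorphism from it back to `M`
preserves supports and so is an MSR quotient. -/
theorem IsMSRPseudovariety.of_injective {𝒱 : Set (NomMon.{u} 𝔸)} (h𝒱 : IsMSRPseudovariety 𝒱)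
    {M N : NomMon.{u} 𝔸} (hN : N ∈ 𝒱) {f : M →* N} (hf : Equivariant 𝔸 f)
    (hinj : Function.Injective f) : M ∈ 𝒱 := by
  have hR : IsNominalSubmonoid N (MonoidHom.mrange f) := by
    rintro π _ ⟨x, rfl⟩
    exact ⟨π • x, hf π x⟩
  let e : M ≃* MonoidHom.mrange f :=
    MulEquiv.ofBijective f.mrangeRestrict
      ⟨fun x y h => hinj (congrArg Subtype.val h), f.mrangeRestrict_surjective⟩
  let e' : N.sub _ hR →* M := e.symm.toMonoidHom
  have he : ∀ x, e' (e x) = x := e.symm_apply_apply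
  have hequiv : Equivariant 𝔸 e' := by
    intro π y
    obtain ⟨x, rfl⟩ := e.surjective y
    let y : N.sub _ hR := e x
    have hy : π • y = e (π • x) := Subtype.ext (hf π x).symm
    exact (congrArg e' hy).trans ((he _).trans (congrArg (π • ·) (he x).symm))
  have hinj' : Function.Injective e' := e.symm.injective
  exact h𝒱.of_surjective (h𝒱.sub N hN _ hR) hequiv e.symm.surjective
    fun x => (hequiv.supp_eq hinj' x).ge

end Monoids

/-! ### Directed sets of bounded quotients -/

section Quotients

variable {𝔸 : Type} {Sg : Type u} [MulAction (FinPerm 𝔸) Sg]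

/-- The nominal monoid presented by an equivariant congruence. -/
def EqvCon.toNomMon [IsNominal 𝔸 Sg] (c : EqvCon 𝔸 Sg) : NomMon.{u} 𝔸 := ⟨c.Quot⟩

/-- The `s`-bounded quotients of the free monoid that belong to a class of nominal monoids. -/
def quotientsIn [IsNominal 𝔸 Sg] (𝒱 : Set (NomMon.{u} 𝔸)) (s : SupportBound 𝔸 Sg) :
    Set (BoundedQuotient s) :=
  {q | q.toNomMon ∈ 𝒱}

/-- Every finite subset of `𝒬` has a lower bound in `𝒬`. -/
def Codirected {s : SupportBound 𝔸 Sg} (𝒬 : Set (BoundedQuotient s)) : Prop :=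
  ∀ F ⊆ 𝒬, F.Finite → ∃ r ∈ 𝒬, ∀ q ∈ F, r.con ≤ q.con

theorem Codirected.nonempty {s : SupportBound 𝔸 Sg} {𝒬 : Set (BoundedQuotient s)}
    (h : Codirected 𝒬) : 𝒬.Nonempty := by
  obtain ⟨r, hr, -⟩ := h ∅ (Set.empty_subset _) Set.finite_empty
  exact ⟨r, hr⟩

theorem Codirected.pair {s : SupportBound 𝔸 Sg} {𝒬 : Set (BoundedQuotient s)}
    (h : Codirected 𝒬) {p q : BoundedQuotient s} (hp : p ∈ 𝒬) (hq : q ∈ 𝒬) :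
    ∃ r ∈ 𝒬, r.con ≤ p.con ∧ r.con ≤ q.con := by
  obtain ⟨r, hr, hle⟩ := h {p, q} (by simp [Set.insert_subset_iff, hp, hq]) (Set.toFinite _)
  exact ⟨r, hr, hle p (by simp), hle q (by simp)⟩

variable [IsNominal 𝔸 Sg] {s : SupportBound 𝔸 Sg}

theorem coimage_mem_quotientsIn {𝒱 : Set (NomMon.{u} 𝔸)} (h𝒱 : IsMSRPseudovariety 𝒱)
    {M : NomMon.{u} 𝔸} (hM : M ∈ 𝒱) (hof : OrbitFinite 𝔸 M) (h : FreeMonoid Sg →* M)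
    (hh : IsBoundedMorphism s h) : BoundedQuotient.coimage hof h hh ∈ quotientsIn 𝒱 s :=
  h𝒱.of_injective (M := (EqvCon.ker h hh.equivariant).toNomMon) hM
    (f := EqvCon.kerLift h hh.equivariant) (EqvCon.kerLift_smul h hh.equivariant)
    (EqvCon.kerLift_injective h hh.equivariant)

/-- The lower bound is the coimage of the tuple of quotient maps into the product. It is again
`s`-bounded because the support of a tuple lies in the union of the supports of its components, all
contained in `s w`. -/
theorem codirected_quotientsIn [Infinite 𝔸] {𝒱 : Set (NomMon.{u} 𝔸)}
    (h𝒱 : IsMSRPseudovariety 𝒱) (s : SupportBound 𝔸 Sg) : Codirected (quotientsIn 𝒱 s) := by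
  intro F hF hfin
  obtain ⟨n, q, -, rfl⟩ := hfin.fin_param
  have hmem : NomMon.prod (fun i => (q i).toNomMon) ∈ 𝒱 :=
    h𝒱.prod n _ fun i => hF ⟨i, rfl⟩
  let h : FreeMonoid Sg →* NomMon.prod (fun i => (q i).toNomMon) :=
    MonoidHom.pi fun i => (q i).quotMk
  have hh : IsBoundedMorphism s h :=
    { equivariant := fun _ _ => rfl
      supp_subset := fun w => (supp_pi_subset (Z := fun i => ((q i).toNomMon : Type u))
        (fun i => (q i).quotMk w)).trans
          (Set.iUnion_subset fun i => (q i).bounded.supp_subset w) }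
  refine ⟨_, coimage_mem_quotientsIn h𝒱 hmem (h𝒱.orbitFinite _ hmem) h hh, ?_⟩
  rintro _ ⟨i, rfl⟩ v w hvw
  have hvw' : h v = h w := hvw
  exact (Con.eq _).1 (congrFun hvw' i)

theorem codirected_univ [Infinite 𝔸] (s : SupportBound 𝔸 Sg) :
    Codirected (Set.univ : Set (BoundedQuotient s)) := by
  have : (Set.univ : Set (BoundedQuotient s)) =
      quotientsIn {M : NomMon.{u} 𝔸 | OrbitFinite 𝔸 M} s :=
    (Set.eq_univ_of_forall fun q => q.orbitFinite).symm
  rw [this]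
  exact codirected_quotientsIn isMSRPseudovariety_orbitFinite s

end Quotients

/-! ### Pro-orbit-finite words -/

section ProWord

variable {𝔸 : Type} {Sg : Type u} [MulAction (FinPerm 𝔸) Sg] {s : SupportBound 𝔸 Sg}

theorem ProWord.proj_congr {q r : BoundedQuotient s} (h : q.con ≤ r.con) {x y : ProWord s}
    (hxy : x.proj q = y.proj q) : x.proj r = y.proj r := by
  rw [ProWord.proj, ProWord.proj, ← x.2.1 q r h, ← y.2.1 q r h]
  exact congrArg _ hxy

theorem ProWord.ext {x y : ProWord s} (h : ∀ q : BoundedQuotient s, x.proj q = y.proj q) : x = y :=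
  Subtype.ext (funext h)

theorem BoundedQuotient.encard_supp_le {k : ℕ} (hk : ∀ w, (s w).card ≤ k)
    (q : BoundedQuotient s) (x : q.Quot) : (supp 𝔸 x).encard ≤ k := by
  obtain ⟨w, rfl⟩ := q.quotMk_surjective x
  refine (Set.encard_le_encard (q.bounded.supp_subset w)).trans ?_
  rw [Set.encard_coe_eq_coe_finsetCard]
  exact_mod_cast hk w

/-- The pro-orbit-finite word represented by a word. -/
def ProWord.ofWord [IsNominal 𝔸 Sg] (s : SupportBound 𝔸 Sg) (w : FreeMonoid Sg) : ProWord s :=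
  ⟨fun q => q.quotMk w, fun _ _ _ => rfl, by
    obtain ⟨S, hS⟩ := IsNominal.finSupp (𝔸 := 𝔸) w
    exact ⟨S, fun π hπ => funext fun q => by
      rw [Pi.smul_apply, ← EqvCon.quotMk_smul, hS π hπ]⟩⟩

/-- Naturality of `ĥ` in the target monoid, used to transfer factorizations along projections,
inclusions and quotients. -/
theorem ProWord.extend_comp {M N : Type u} [Monoid M] [MulDistribMulAction (FinPerm 𝔸) M]
    [Monoid N] [MulDistribMulAction (FinPerm 𝔸) N] (hM : OrbitFinite 𝔸 M)
    (hN : OrbitFinite 𝔸 N) (f : M →* N) (h : FreeMonoid Sg →* M) (hh : IsBoundedMorphism s h)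
    (hfh : IsBoundedMorphism s (f.comp h)) (x : ProWord s) :
    ProWord.extend hN (f.comp h) hfh x = f (ProWord.extend hM h hh x) := by
  have hle : (BoundedQuotient.coimage hM h hh).con ≤
      (BoundedQuotient.coimage hN (f.comp h) hfh).con := by
    intro v w hvw
    have hvw' : h v = h w := hvw
    exact congrArg f hvw'
  have hx := x.2.1 _ _ hle
  obtain ⟨w, hw⟩ := EqvCon.quotMk_surjective _ (x.1 (BoundedQuotient.coimage hM h hh))
  unfold ProWord.extend ProWord.proj
  rw [← hx, ← hw]
  rfl

variable [IsNominal 𝔸 Sg]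

/-- The projections of a pro-orbit-finite word to a codirected set of quotients have a greatest
support. -/
theorem ProWord.exists_supp_proj_subset [Infinite 𝔸] {𝒬 : Set (BoundedQuotient s)}
    (h𝒬 : Codirected 𝒬) (x : ProWord s) :
    ∃ p ∈ 𝒬, ∀ q ∈ 𝒬, supp 𝔸 (x.proj q) ⊆ supp 𝔸 (x.proj p) := by
  obtain ⟨k, hk⟩ := s.bounded
  have hfin : ∀ q : BoundedQuotient s, (supp 𝔸 (x.proj q)).Finite := fun q =>
    (IsNominal.finSupp (x.proj q)).finite_supp
  -- Take `p` with the largest support, which exists as `s` bounds the sizes. A common refinement of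
  -- `p` and `q` can only enlarge supports, so by maximality it has the support of `p`, which
  -- therefore contains that of `q`.
  let N : Set ℕ := (fun q : BoundedQuotient s => (supp 𝔸 (x.proj q)).ncard) '' 𝒬
  have hN : BddAbove N := by
    refine ⟨k, ?_⟩
    rintro _ ⟨q, -, rfl⟩
    have := q.encard_supp_le hk (x.proj q)
    rw [← (hfin q).cast_ncard_eq] at this
    exact_mod_cast this
  obtain ⟨p, hp, hpN⟩ := Nat.sSup_mem (h𝒬.nonempty.image _) hN
  have hmap : ∀ {r q : BoundedQuotient s}, r.con ≤ q.con →
      supp 𝔸 (x.proj q) ⊆ supp 𝔸 (x.proj r) := by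
    intro r q h
    rw [ProWord.proj, ← x.2.1 r q h]
    exact Equivariant.supp_subset (EqvCon.map_smul _ _ h) _
  refine ⟨p, hp, fun q hq => ?_⟩
  obtain ⟨r, hr, hrp, hrq⟩ := h𝒬.pair hp hq
  have : supp 𝔸 (x.proj p) = supp 𝔸 (x.proj r) :=
    Set.eq_of_subset_of_ncard_le (hmap hrp) ((le_csSup hN ⟨r, hr, rfl⟩).trans hpN.ge) (hfin r)
  rw [this]
  exact hmap hrq

theorem ProWord.isBounded [Infinite 𝔸] {k : ℕ} (hk : ∀ w, (s w).card ≤ k) :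
    IsBounded 𝔸 k (ProWord s) := by
  intro x
  obtain ⟨p, -, hp⟩ := x.exists_supp_proj_subset (codirected_univ s)
  refine (Set.encard_le_encard (supp_subset (IsNominal.finSupp (x.proj p)).finite_supp
    fun π hπ => ProWord.ext fun q => ?_)).trans (p.encard_supp_le hk (x.proj p))
  exact (IsNominal.finSupp (x.proj q)).supports_supp π fun a ha => hπ (hp q trivial ha)

end ProWord

/-! ### Classes presented by morphic proequations -/

section Satisfies

variable {𝔸 : Type}

/-- The boundedness clauses hold automatically: the codomain of `φ` is an equivariant image of the
pro-orbit-finite words, which inherit the bound of `s`. -/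
theorem satisfies_iff [Infinite 𝔸] {M : NomMon.{u} 𝔸} {hM : OrbitFinite 𝔸 M}
    {φ : MorphicProequation.{u} 𝔸} :
    Satisfies M hM φ ↔ ∀ (h : FreeMonoid φ.Alphabet →* M) (hh : IsBoundedMorphism φ.bound h),
      ∃ g : φ.Codomain → M, IsMorphism φ.topology (NomTop.discrete 𝔸 M) g ∧
        ∀ x : ProWord φ.bound, ProWord.extend hM h hh x = g (φ.map x) := by
  constructor
  · intro H h hh
    obtain ⟨-, -, -, -, hg⟩ := H h hh
    exact hg
  · intro H h hh
    obtain ⟨k, hk⟩ := φ.bound.bounded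
    obtain ⟨l, hl⟩ := hM.exists_isBounded
    exact ⟨max k l, hl.mono (le_max_right _ _), fun w => (hk w).trans (le_max_left _ _),
      ((ProWord.isBounded hk).of_surjective φ.isMorphism.equivariant φ.surjective).mono
        (le_max_left _ _), H h hh⟩

variable {X Y Z : Type u} [MulAction (FinPerm 𝔸) X] [MulAction (FinPerm 𝔸) Y]
  [MulAction (FinPerm 𝔸) Z]

theorem Equivariant.comp {g : Y → Z} {f : X → Y} (hg : Equivariant 𝔸 g)
    (hf : Equivariant 𝔸 f) : Equivariant 𝔸 (g ∘ f) :=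
  fun π x => by rw [Function.comp_apply, hf, hg, Function.comp_apply]

theorem Equivariant.smul_preimage {f : X → Y} (hf : Equivariant 𝔸 f) (π : FinPerm 𝔸)
    (A : Set Y) : π • f ⁻¹' A = f ⁻¹' (π • A) := by
  ext x
  simp only [Set.mem_smul_set_iff_inv_smul_mem, Set.mem_preimage]
  rw [hf]

theorem Equivariant.finSupp_preimage {f : X → Y} (hf : Equivariant 𝔸 f) {A : Set Y}
    (hA : FinSupp 𝔸 A) : FinSupp 𝔸 (f ⁻¹' A) := by
  obtain ⟨S, hS⟩ := hA
  exact ⟨S, fun π hπ => by rw [hf.smul_preimage, hS π hπ]⟩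

theorem Equivariant.finSupp_preimage_singleton [IsNominal 𝔸 Y] {f : X → Y}
    (hf : Equivariant 𝔸 f) (y : Y) : FinSupp 𝔸 (f ⁻¹' {y}) := by
  obtain ⟨S, hS⟩ := IsNominal.finSupp (𝔸 := 𝔸) y
  exact hf.finSupp_preimage ⟨S, fun π hπ => by rw [Set.smul_set_singleton, hS π hπ]⟩

theorem IsMorphism.comp_discrete {tX : NomTop 𝔸 X} {g : Y → Z} {f : X → Y}
    (hg : Equivariant 𝔸 g) (hf : IsMorphism tX (NomTop.discrete 𝔸 Y) f) :
    IsMorphism tX (NomTop.discrete 𝔸 Z) (g ∘ f) where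
  equivariant := hg.comp hf.equivariant
  continuous _ hU := hf.continuous _ (hg.finSupp_preimage hU)

/-- Equivariant maps into a discrete nominal space are continuous if the preimages of points are
open. -/
theorem isMorphism_discrete {tX : NomTop 𝔸 X} {f : X → Y} (hf : Equivariant 𝔸 f)
    (h : ∀ y, tX.IsOpen (f ⁻¹' {y})) : IsMorphism tX (NomTop.discrete 𝔸 Y) f where
  equivariant := hf
  continuous A hA := by
    have : f ⁻¹' A = ⋃₀ ((fun y => f ⁻¹' {y}) '' A) := by
      ext x
      simp
    rw [this]
    refine tX.sUnion _ ?_ (by rintro _ ⟨y, -, rfl⟩; exact h y)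
    obtain ⟨S, hS⟩ := hA
    refine ⟨S, fun π hπ => ?_⟩
    conv_rhs => rw [← hS π hπ]
    rw [← Set.image_smul, ← Set.image_smul, Set.image_image, Set.image_image]
    exact Set.image_congr fun y _ => by rw [hf.smul_preimage, Set.smul_set_singleton]

theorem IsBoundedMorphism.comp {Sg : Type u} [MulAction (FinPerm 𝔸) Sg]
    {s : SupportBound 𝔸 Sg} {M N : NomMon.{u} 𝔸} {f : M →* N} (hf : Equivariant 𝔸 f)
    {h : FreeMonoid Sg →* M} (hh : IsBoundedMorphism s h) : IsBoundedMorphism s (f.comp h) where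
  equivariant := hf.comp hh.equivariant
  supp_subset w := (hf.supp_subset (h w)).trans (hh.supp_subset w)

theorem NomTop.isOpen_iInter (tX : NomTop 𝔸 X) {n : ℕ} (U : Fin n → Set X)
    (hU : ∀ i, tX.IsOpen (U i)) : tX.IsOpen (⋂ i, U i) := by
  induction n with
  | zero =>
    rw [Set.iInter_of_empty]
    exact tX.univ
  | succ n ih =>
    have : ⋂ i, U i = U 0 ∩ ⋂ i : Fin n, U i.succ := by
      ext x
      simp [Fin.forall_fin_succ]
    rw [this]
    exact tX.inter _ _ (hU 0) (ih _ fun i => hU i.succ)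

/-! ### Closure of satisfaction under products, submonoids and MSR quotients. -/

theorem Satisfies.prod [Infinite 𝔸] {n : ℕ} {M : Fin n → NomMon.{u} 𝔸}
    {hM : ∀ i, OrbitFinite 𝔸 (M i)} {φ : MorphicProequation.{u} 𝔸}
    (hφ : ∀ i, Satisfies (M i) (hM i) φ) (hP : OrbitFinite 𝔸 (NomMon.prod M)) :
    Satisfies (NomMon.prod M) hP φ := by
  rw [satisfies_iff]
  intro h hh
  let p : ∀ i, NomMon.prod M →* M i := fun i => Pi.evalMonoidHom (fun i => (M i : Type u)) i
  have hp : ∀ i, Equivariant 𝔸 (p i) := fun i _ _ => rfl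
  have hph : ∀ i, IsBoundedMorphism φ.bound ((p i).comp h) := fun i => hh.comp (hp i)
  choose g hg hgφ using fun i => satisfies_iff.1 (hφ i) ((p i).comp h) (hph i)
  let G : φ.Codomain → NomMon.prod M := fun y i => g i y
  refine ⟨G, isMorphism_discrete (fun π y => funext fun i => (hg i).equivariant π y)
    fun m => ?_, fun x => funext fun i => ?_⟩
  · have : G ⁻¹' {m} = ⋂ i, g i ⁻¹' {m i} := by
      ext y
      simp only [Set.mem_preimage, Set.mem_singleton_iff, Set.mem_iInter]
      exact funext_iff
    rw [this]
    refine φ.topology.isOpen_iInter _ fun i => (hg i).continuous _ ?_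
    exact Equivariant.finSupp_preimage_singleton (f := id) (fun _ _ => rfl) _
  · exact (ProWord.extend_comp hP (hM i) (p i) h hh (hph i) x).symm.trans (hgφ i x)

theorem Satisfies.sub [Infinite 𝔸] {M : NomMon.{u} 𝔸} {hM : OrbitFinite 𝔸 M}
    {φ : MorphicProequation.{u} 𝔸} (hφ : Satisfies M hM φ) (N : Submonoid M)
    (hN : IsNominalSubmonoid M N) (hof : OrbitFinite 𝔸 (M.sub N hN)) :
    Satisfies (M.sub N hN) hof φ := by
  rw [satisfies_iff]
  intro h hh
  have hιh := hh.comp (M.subtype_equivariant N hN)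
  obtain ⟨g, hg, hgφ⟩ := satisfies_iff.1 hφ _ hιh
  have hext : ∀ x, g (φ.map x) = M.subtype N hN (ProWord.extend hof h hh x) := fun x =>
    (hgφ x).symm.trans (ProWord.extend_comp hof hM _ h hh hιh x)
  -- Surjectivity of `φ` forces `g` to take values in `N`. The chosen preimages only serve to define
  -- the corestriction; equivariance and continuity come from `g`.
  let G : φ.Codomain → M.sub N hN := fun y => ProWord.extend hof h hh
    (Function.surjInv φ.surjective y)
  have hG : ∀ y, M.subtype N hN (G y) = g y := fun y => by
    rw [← hext, Function.surjInv_eq φ.surjective]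
  refine ⟨G, isMorphism_discrete (fun π y => M.subtype_injective N hN ?_) fun m => ?_,
    fun x => M.subtype_injective N hN ?_⟩
  · rw [hG, M.subtype_equivariant, hG]
    exact hg.equivariant π y
  · have : G ⁻¹' {m} = g ⁻¹' {M.subtype N hN m} := by
      ext y
      simp only [Set.mem_preimage, Set.mem_singleton_iff, ← hG]
      exact (M.subtype_injective N hN).eq_iff.symm
    rw [this]
    exact hg.continuous _ (Equivariant.finSupp_preimage_singleton (f := id) (fun _ _ => rfl) _)
  · rw [hG, hext]

theorem equivariant_lift {Sg : Type u} [MulAction (FinPerm 𝔸) Sg] {M : NomMon.{u} 𝔸}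
    {f : Sg → M} (hf : Equivariant 𝔸 f) : Equivariant 𝔸 (FreeMonoid.lift f) := by
  intro π w
  induction w using FreeMonoid.inductionOn' with
  | one => rw [smul_one, map_one, smul_one]
  | of_mul x w ih =>
    have : π • FreeMonoid.of x = FreeMonoid.of (π • x) := rfl
    rw [smul_mul', map_mul, ih, map_mul, smul_mul', this, FreeMonoid.lift_eval_of,
      FreeMonoid.lift_eval_of, hf]

theorem supp_of_subset {Sg : Type u} [MulAction (FinPerm 𝔸) Sg] (x : Sg) :
    supp 𝔸 (FreeMonoid.of x) ⊆ supp 𝔸 x :=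
  Equivariant.supp_subset (f := FreeMonoid.of) (fun _ _ => rfl) x

/-- Preimages of the letters' values are chosen in `M'`, where `e` preserves supports, so strength
of the alphabet makes the choice equivariant. All values of the lift stay in the submonoid `M'` and
keep the supports of `h`, so the lift is `s`-bounded and its factorization can be composed with `e`.
-/
theorem Satisfies.quotient [Infinite 𝔸] {M N : NomMon.{u} 𝔸} {hM : OrbitFinite 𝔸 M}
    {φ : MorphicProequation.{u} 𝔸} (hφ : Satisfies M hM φ) {e : M →* N} (he : IsMSRQuotient e)
    (hN : OrbitFinite 𝔸 N) : Satisfies N hN φ := by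
  rw [satisfies_iff]
  intro h hh
  obtain ⟨M', hM', hsurj, hsupp⟩ := he.exists_submonoid
  obtain ⟨f, hf, hfR⟩ := φ.alphabet_strong.exists_equivariant
    (fun x y => y ∈ M' ∧ e y = h (FreeMonoid.of x))
    (fun π x y hxy => ⟨hM' π y hxy.1, by
      rw [he.equivariant, hxy.2, ← hh.equivariant]
      rfl⟩)
    (fun x => by
      obtain ⟨y, hy, hyx⟩ := hsurj (h (FreeMonoid.of x))
      refine ⟨y, ⟨hy, hyx⟩, ?_⟩
      rw [← hsupp y hy, hyx]
      exact (hh.equivariant.supp_subset _).trans (supp_of_subset x))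
  have hlift : e.comp (FreeMonoid.lift f) = h := FreeMonoid.hom_eq fun x => by
    rw [MonoidHom.comp_apply, FreeMonoid.lift_eval_of, (hfR x).2]
  have hmem : ∀ w, FreeMonoid.lift f w ∈ M' := fun w => by
    induction w using FreeMonoid.inductionOn' with
    | one =>
      rw [map_one]
      exact M'.one_mem
    | of_mul x w ih =>
      rw [map_mul, FreeMonoid.lift_eval_of]
      exact M'.mul_mem (hfR x).1 ih
  have hb : IsBoundedMorphism φ.bound (FreeMonoid.lift f) :=
    { equivariant := equivariant_lift hf
      supp_subset := fun w => by
        rw [← hsupp _ (hmem w)]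
        have : e (FreeMonoid.lift f w) = h w := DFunLike.congr_fun hlift w
        rw [this]
        exact hh.supp_subset w }
  obtain ⟨g, hg, hgφ⟩ := satisfies_iff.1 hφ _ hb
  subst hlift
  exact ⟨e ∘ g, hg.comp_discrete he.equivariant, fun x => by
    rw [Function.comp_apply, ← hgφ, ProWord.extend_comp hM hN e _ hb hh]⟩

theorem IsPresentable.isMSRPseudovariety [Infinite 𝔸] {𝒱 : Set (NomMon.{u} 𝔸)}
    (h : IsPresentable 𝒱) : IsMSRPseudovariety 𝒱 := by
  obtain ⟨T, -, hT⟩ := h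
  have hof : ∀ M ∈ 𝒱, OrbitFinite 𝔸 M := fun M hM => ((hT M).1 hM).1
  have hsat : ∀ (M) (hM : M ∈ 𝒱), ∀ φ ∈ T, Satisfies M (hof M hM) φ := fun M hM =>
    ((hT M).1 hM).2
  exact
    { orbitFinite := hof
      prod := fun n M hM => (hT _).2 ⟨isMSRPseudovariety_orbitFinite.prod n M
        fun i => hof _ (hM i), fun φ hφ => Satisfies.prod (fun i => hsat _ (hM i) φ hφ) _⟩
      sub := fun M hM N hN => (hT _).2 ⟨isMSRPseudovariety_orbitFinite.sub M (hof M hM) N hN,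
        fun φ hφ => (hsat M hM φ hφ).sub N hN _⟩
      quotient := fun M hM N e he => (hT _).2
        ⟨isMSRPseudovariety_orbitFinite.quotient M (hof M hM) N e he,
          fun φ hφ => (hsat M hM φ hφ).quotient he _⟩ }

end Satisfies

/-! ### The image of the pro-orbit-finite words in a limit of some of the quotients -/

section ProImage

variable {𝔸 : Type} {Sg : Type u} [MulAction (FinPerm 𝔸) Sg] {s : SupportBound 𝔸 Sg}

/-- Compactness of the space of pro-orbit-finite words supported by `T`. -/
theorem ProWord.exists_finite_subcover [Infinite 𝔸] [IsNominal 𝔸 Sg] (T : Finset 𝔸)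
    (f : ProWord s → BoundedQuotient s) :
    ∃ F : Set (ProWord s), F.Finite ∧ ∀ y : ProWord s,
      MulAction.Supports (FinPerm 𝔸) (T : Set 𝔸) y → ∃ x ∈ F, y.proj (f x) = x.proj (f x) := by
  let _ : ∀ q : BoundedQuotient s, TopologicalSpace q.Quot := fun _ => ⊥
  have : ∀ q : BoundedQuotient s, DiscreteTopology q.Quot := fun _ => ⟨rfl⟩
  let C : Set (∀ q : BoundedQuotient s, q.Quot) :=
    {x | ∀ (q r : BoundedQuotient s) (h : q.con ≤ r.con), q.map r.toEqvCon h (x q) = x r}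
  let P : Set (∀ q : BoundedQuotient s, q.Quot) := Set.univ.pi fun q =>
    {x : q.Quot | MulAction.Supports (FinPerm 𝔸) (T : Set 𝔸) x}
  have hC : IsClosed C := by
    simp only [C, Set.ofPred_forall]
    refine isClosed_iInter fun q => isClosed_iInter fun r => isClosed_iInter fun h => ?_
    exact isClosed_eq (continuous_of_discreteTopology.comp (continuous_apply q))
      (continuous_apply r)
  have hP : _root_.IsCompact P := isCompact_univ_pi fun q =>
    (q.orbitFinite.finite_supported T).isCompact
  -- Componentwise support by one finite set `T` makes the whole family finitely supported. So the
  -- compact set `P ∩ C`, closed in a product of finite sets, consists of pro-orbit-finite words.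
  let w : ∀ x ∈ P ∩ C, ProWord s := fun x hx => ⟨x, hx.2, T, fun π hπ => funext fun q =>
    hx.1 q trivial π hπ⟩
  obtain ⟨t, ht⟩ := (hP.inter_right hC).elim_nhds_subcover'
    (fun x hx => {y | y (f (w x hx)) = x (f (w x hx))}) fun x hx =>
      ((isOpen_discrete {x (f (w x hx))}).preimage (continuous_apply (f (w x hx)))).mem_nhds
        (Set.mem_singleton _)
  refine ⟨(fun x : ↥(P ∩ C) => w x x.2) '' (t : Set ↥(P ∩ C)), t.finite_toSet.image _,
    fun y hy => ?_⟩
  have hyPC : y.1 ∈ P ∩ C :=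
    ⟨fun q _ π hπ => congrArg (ProWord.proj q) (hy π hπ), y.2.1⟩
  obtain ⟨x, hx, hyx⟩ := Set.mem_iUnion₂.1 (ht hyPC)
  exact ⟨_, ⟨x, hx, rfl⟩, hyx⟩

/-- The tuple of projections of a pro-orbit-finite word to the quotients in `𝒬`. -/
def ProWord.tuple (𝒬 : Set (BoundedQuotient s)) (x : ProWord s) (q : 𝒬) : q.1.Quot :=
  x.proj q.1

/-- The set of all tuples of projections of pro-orbit-finite words to the quotients in `𝒬`. -/
def ProImage (𝒬 : Set (BoundedQuotient s)) : Type u :=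
  Set.range (ProWord.tuple 𝒬)

variable {𝒬 : Set (BoundedQuotient s)}

instance : MulAction (FinPerm 𝔸) (ProImage 𝒬) where
  smul π e := ⟨π • e.1, by
    obtain ⟨x, hx⟩ := e.2
    exact ⟨π • x, congrArg (π • ·) hx⟩⟩
  one_smul e := Subtype.ext (one_smul _ e.1)
  mul_smul π σ e := Subtype.ext (mul_smul π σ e.1)

/-- The restriction of a pro-orbit-finite word to the quotients in `𝒬`. -/
def ProWord.restrict (𝒬 : Set (BoundedQuotient s)) (x : ProWord s) : ProImage 𝒬 :=
  ⟨ProWord.tuple 𝒬 x, x, rfl⟩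

theorem ProWord.restrict_surjective : Function.Surjective (ProWord.restrict 𝒬) := by
  rintro ⟨_, x, rfl⟩
  exact ⟨x, rfl⟩

theorem ProWord.restrict_equivariant : Equivariant 𝔸 (ProWord.restrict 𝒬) :=
  fun _ _ => rfl

/-- The projections of `ProImage 𝒬`. -/
def ProImage.proj (q : 𝒬) (e : ProImage 𝒬) : q.1.Quot :=
  e.1 q

theorem ProImage.proj_equivariant (q : 𝒬) :
    Equivariant 𝔸 (ProImage.proj q : ProImage 𝒬 → q.1.Quot) :=
  fun _ _ => rfl

theorem ProImage.ext {d e : ProImage 𝒬} (h : ∀ q, d.proj q = e.proj q) : d = e :=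
  Subtype.ext (funext h)

theorem ProImage.proj_congr {q r : 𝒬} (h : q.1.con ≤ r.1.con) {d e : ProImage 𝒬}
    (hde : d.proj q = e.proj q) : d.proj r = e.proj r := by
  obtain ⟨x, rfl⟩ := ProWord.restrict_surjective d
  obtain ⟨y, rfl⟩ := ProWord.restrict_surjective e
  exact ProWord.proj_congr (x := x) (y := y) h hde

instance [IsNominal 𝔸 Sg] : IsNominal 𝔸 (ProImage 𝒬) where
  finSupp e := by
    obtain ⟨x, rfl⟩ := ProWord.restrict_surjective e
    obtain ⟨S, hS⟩ := IsNominal.finSupp (𝔸 := 𝔸) x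
    exact ⟨S, ProWord.restrict_equivariant.supports hS⟩

/-- The initial topology with respect to the projections to the discrete quotients. -/
def ProImage.topology (h𝒬 : Codirected 𝒬) : NomTop 𝔸 (ProImage 𝒬) where
  IsOpen U := FinSupp 𝔸 U ∧ ∀ d ∈ U, ∃ q : 𝒬, ∀ e : ProImage 𝒬, e.proj q = d.proj q → e ∈ U
  finSupp _ h := h.1
  smul π U h := by
    refine ⟨h.1.smul π, fun d hd => ?_⟩
    rw [Set.mem_smul_set_iff_inv_smul_mem] at hd
    obtain ⟨q, hq⟩ := h.2 _ hd
    refine ⟨q, fun e he => ?_⟩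
    rw [Set.mem_smul_set_iff_inv_smul_mem]
    exact hq _ (congrArg (fun z => π⁻¹ • z) he)
  sUnion 𝒰 h𝒰 h := by
    refine ⟨h𝒰.sUnion, ?_⟩
    rintro d ⟨U, hU, hd⟩
    obtain ⟨q, hq⟩ := (h U hU).2 d hd
    exact ⟨q, fun e he => ⟨U, hU, hq e he⟩⟩
  univ := ⟨FinSupp.univ, fun _ _ => ⟨⟨_, h𝒬.nonempty.some_mem⟩, fun _ _ => trivial⟩⟩
  inter U V hU hV := by
    refine ⟨hU.1.inter hV.1, ?_⟩
    rintro d ⟨hdU, hdV⟩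
    obtain ⟨p, hp⟩ := hU.2 d hdU
    obtain ⟨q, hq⟩ := hV.2 d hdV
    -- Codirectedness allows neighbourhoods to be described by a single projection instead of
    -- finitely many.
    obtain ⟨r, hr, hrp, hrq⟩ := h𝒬.pair p.2 q.2
    exact ⟨⟨r, hr⟩, fun e he => ⟨hp e (ProImage.proj_congr (q := ⟨r, hr⟩) hrp he),
      hq e (ProImage.proj_congr (q := ⟨r, hr⟩) hrq he)⟩⟩

theorem ProImage.isOpen_proj_preimage (h𝒬 : Codirected 𝒬) (q : 𝒬) {A : Set q.1.Quot}
    (hA : FinSupp 𝔸 A) : (ProImage.topology h𝒬).IsOpen (ProImage.proj q ⁻¹' A) :=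
  ⟨(ProImage.proj_equivariant q).finSupp_preimage hA, fun d hd => ⟨q, fun e he => by
    rwa [Set.mem_preimage, he]⟩⟩

theorem ProImage.isMorphism_proj (h𝒬 : Codirected 𝒬) (q : 𝒬) :
    IsMorphism (ProImage.topology h𝒬) (NomTop.discrete 𝔸 q.1.Quot) (ProImage.proj q) where
  equivariant := ProImage.proj_equivariant q
  continuous _ hA := ProImage.isOpen_proj_preimage h𝒬 q hA

theorem ProWord.isMorphism_restrict (h𝒬 : Codirected 𝒬) :
    IsMorphism (ProWord.topology s) (ProImage.topology h𝒬) (ProWord.restrict 𝒬) where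
  equivariant := ProWord.restrict_equivariant
  continuous U hU := by
    refine ⟨ProWord.restrict_equivariant.finSupp_preimage hU.1, fun x hx => ?_⟩
    obtain ⟨q, hq⟩ := hU.2 _ hx
    exact ⟨{q.1}, Set.finite_singleton _, fun y hy => hq _ (hy q.1 rfl)⟩

theorem supports_of_smul_mem {X : Type u} [MulAction (FinPerm 𝔸) X] {B : Set 𝔸} {U : Set X}
    (h : ∀ π : FinPerm 𝔸, (∀ a ∈ B, π • a = a) → ∀ x ∈ U, π • x ∈ U) :
    MulAction.Supports (FinPerm 𝔸) B U := by
  intro π hπ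
  refine Set.Subset.antisymm ?_ fun x hx => ?_
  · rintro _ ⟨x, hx, rfl⟩
    exact h π (fun a ha => hπ ha) x hx
  · rw [Set.mem_smul_set_iff_inv_smul_mem]
    exact h π⁻¹ (fun a ha => by rw [inv_smul_eq_iff, hπ ha]) x hx

/-! ### The Stone property of `ProImage`. -/

variable [IsNominal 𝔸 Sg]

/-- If `S` supports the cover and `T` adds `k` names to `S`, finitely many members cover the images
of all `T`-supported words. Every word becomes `T`-supported after a permutation fixing `S`, so the
translates of these members under such permutations cover everything and stay inside the cover. -/
theorem ProImage.isCompact [Infinite 𝔸] (h𝒬 : Codirected 𝒬) :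
    (ProImage.topology h𝒬).IsCompact := by
  rintro 𝒞 ⟨S, hS⟩ hopen hcover
  obtain ⟨k, hk⟩ := s.bounded
  obtain ⟨T, hST, hT⟩ := exists_superset_card S k
  have hx : ∀ x : ProWord s, ∃ U ∈ 𝒞, ∃ q : 𝒬, ∀ e : ProImage 𝒬,
      e.proj q = (x.restrict 𝒬).proj q → e ∈ U := fun x => by
    obtain ⟨U, hU, hxU⟩ : x.restrict 𝒬 ∈ ⋃₀ 𝒞 := hcover ▸ Set.mem_univ _
    exact ⟨U, hU, (hopen U hU).2 _ hxU⟩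
  choose U hU q hq using hx
  obtain ⟨F, hF, hFT⟩ := ProWord.exists_finite_subcover T fun x => (q x).1
  let 𝒟 : Set (Set (ProImage 𝒬)) :=
    {V | ∃ x ∈ F, ∃ π : FinPerm 𝔸, (∀ a ∈ S, π • a = a) ∧ π • U x = V}
  refine ⟨𝒟, ?_, ⟨S, supports_of_smul_mem ?_⟩, Set.eq_univ_of_forall fun e => ?_, ?_⟩
  · rintro _ ⟨x, -, π, hπ, rfl⟩
    rw [← hS π hπ]
    exact Set.smul_mem_smul_set (hU x)
  · rintro σ hσ _ ⟨x, hx, π, hπ, rfl⟩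
    exact ⟨x, hx, σ * π, fun a ha => by rw [mul_smul, hπ a ha, hσ a ha], mul_smul _ _ _⟩
  · obtain ⟨x, rfl⟩ := ProWord.restrict_surjective e
    obtain ⟨B, hB, hBx⟩ := (IsNominal.finSupp (𝔸 := 𝔸) x).exists_finset
    obtain ⟨π, hπS, hπB⟩ := exists_finPerm_mapsTo hST B (by
      have := ProWord.isBounded hk x
      rw [← hB, Set.encard_coe_eq_coe_finsetCard] at this
      have : B.card ≤ k := by exact_mod_cast this
      omega)
    obtain ⟨y, hy, hxy⟩ := hFT (π • x) ((supports_smul hBx π).mono (by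
      rintro _ ⟨a, ha, rfl⟩
      exact hπB a ha))
    refine ⟨π⁻¹ • U y, ⟨y, hy, π⁻¹, fun a ha => by rw [inv_smul_eq_iff, hπS a ha], rfl⟩, ?_⟩
    rw [Set.mem_smul_set_iff_inv_smul_mem, inv_inv]
    exact hq y _ hxy
  · refine (hF.image fun x => MulAction.orbit (FinPerm 𝔸) (U x)).subset ?_
    rintro _ ⟨_, ⟨x, hx, π, -, rfl⟩, rfl⟩
    exact ⟨x, hx, (MulAction.orbit_smul _ _).symm⟩

/-- The permutation may vary with `q`, but its effect on `d` depends only on its restriction to `B`,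
the greatest support of a projection. Such restrictions can be taken as maps into a fixed finite set
`C`, so only finitely many are candidates and one of them works for all `q`. -/
theorem ProImage.exists_smul_eq [Infinite 𝔸] (h𝒬 : Codirected 𝒬) (S : Finset 𝔸)
    (d e : ProImage 𝒬)
    (h : ∀ q : 𝒬, ∃ π : FinPerm 𝔸, (∀ a ∈ S, π • a = a) ∧ π • d.proj q = e.proj q) :
    ∃ π : FinPerm 𝔸, (∀ a ∈ S, π • a = a) ∧ π • d = e := by
  obtain ⟨x, rfl⟩ := ProWord.restrict_surjective d
  obtain ⟨p, hp, hmax⟩ := x.exists_supp_proj_subset h𝒬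
  let B := supp 𝔸 (x.proj p)
  let C := supp 𝔸 (e.proj ⟨p, hp⟩)
  have hB : ∀ q : 𝒬, MulAction.Supports (FinPerm 𝔸) B ((x.restrict 𝒬).proj q) := fun q =>
    supports_of_supp_subset (IsNominal.finSupp _) (hmax q.1 q.2)
  have : Finite B := (IsNominal.finSupp (x.proj p)).finite_supp.to_subtype
  have : Finite C := (IsNominal.finSupp (e.proj ⟨p, hp⟩)).finite_supp.to_subtype
  let Good : (B → C) → 𝒬 → Prop := fun c q => ∃ π : FinPerm 𝔸, (∀ a ∈ S, π • a = a) ∧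
    (∀ b : B, π • (b : 𝔸) = c b) ∧ π • (x.restrict 𝒬).proj q = e.proj q
  have mono : ∀ {c} {q r : 𝒬}, q.1.con ≤ r.1.con → Good c q → Good c r := by
    rintro c q r hqr ⟨π, h1, h2, h3⟩
    exact ⟨π, h1, h2, ProImage.proj_congr (d := π • x.restrict 𝒬) hqr h3⟩
  have hgood : ∀ q, ∃ c, Good c q := by
    intro q
    obtain ⟨r, hr, hrp, hrq⟩ := h𝒬.pair hp q.2
    obtain ⟨π, hπS, hπ⟩ := h ⟨r, hr⟩
    have hπp : π • x.proj p = e.proj ⟨p, hp⟩ :=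
      ProImage.proj_congr (q := ⟨r, hr⟩) (r := ⟨p, hp⟩) (d := π • x.restrict 𝒬) hrp hπ
    refine ⟨fun b => ⟨π • (b : 𝔸), ?_⟩, mono (q := ⟨r, hr⟩) hrq ⟨π, hπS, fun _ => rfl, hπ⟩⟩
    change _ ∈ supp 𝔸 _
    rw [← hπp]
    exact smul_mem_supp (IsNominal.finSupp _) π b.2
  obtain ⟨c, hc⟩ : ∃ c, ∀ q, Good c q := by
    -- If each of the finitely many candidates `c` failed at some quotient, all would fail at a
    -- common refinement, contradicting `hgood`.
    by_contra! hcon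
    choose q hq using hcon
    obtain ⟨r, hr, hrq⟩ := h𝒬 (Set.range fun c => (q c).1)
      (by rintro _ ⟨c, rfl⟩; exact (q c).2) (Set.finite_range _)
    obtain ⟨c, hc⟩ := hgood ⟨r, hr⟩
    exact hq c (mono (q := ⟨r, hr⟩) (hrq _ ⟨c, rfl⟩) hc)
  obtain ⟨π, hπS, hπc, -⟩ := hc ⟨p, hp⟩
  refine ⟨π, hπS, ProImage.ext fun q => ?_⟩
  obtain ⟨σ, -, hσc, hσ⟩ := hc q
  rw [← hσ, ProImage.proj_equivariant]
  exact smul_eq_smul_of_supports (hB q) fun a ha =>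
    (hπc ⟨a, ha⟩).trans (hσc ⟨a, ha⟩).symm

/-- By `ProImage.exists_smul_eq`, some projection already separates the `S`-orbits of the two
points; the preimages of these `S`-orbits are the required neighbourhoods. -/
theorem ProImage.isHausdorff [Infinite 𝔸] (h𝒬 : Codirected 𝒬) :
    (ProImage.topology h𝒬).IsHausdorff := by
  intro S d e hde
  obtain ⟨q, hq⟩ : ∃ q : 𝒬, ∀ π : FinPerm 𝔸, (∀ a ∈ S, π • a = a) →
      π • d.proj q ≠ e.proj q := by
    by_contra! hcon
    obtain ⟨π, hπS, hπ⟩ := ProImage.exists_smul_eq h𝒬 S d e hcon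
    exact hde π hπS hπ
  let O : q.1.Quot → Set q.1.Quot := fun x =>
    {y | ∃ π : FinPerm 𝔸, (∀ a ∈ S, π • a = a) ∧ π • x = y}
  have hO : ∀ x, MulAction.Supports (FinPerm 𝔸) (S : Set 𝔸) (O x) := fun x =>
    supports_of_smul_mem (by
      rintro σ hσ _ ⟨π, hπ, rfl⟩
      exact ⟨σ * π, fun a ha => by rw [mul_smul, hπ a ha, hσ a ha], mul_smul _ _ _⟩)
  have hOU : ∀ x, MulAction.Supports (FinPerm 𝔸) (S : Set 𝔸)
      (ProImage.proj q ⁻¹' O x) := fun x π hπ => by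
    rw [(ProImage.proj_equivariant q).smul_preimage, hO x π hπ]
  have hself : ∀ x, x ∈ O x := fun x => ⟨1, by simp, one_smul _ _⟩
  refine ⟨_, _, ProImage.isOpen_proj_preimage h𝒬 q ⟨S, hO (d.proj q)⟩,
    ProImage.isOpen_proj_preimage h𝒬 q ⟨S, hO (e.proj q)⟩, hOU _, hOU _, hself _, hself _,
    Disjoint.preimage _ (Set.disjoint_left.2 ?_)⟩
  rintro _ ⟨π, hπ, rfl⟩ ⟨σ, hσ, h⟩
  refine hq (σ⁻¹ * π) (fun a ha => ?_) ?_
  · rw [mul_smul, hπ a ha, inv_smul_eq_iff, hσ a ha]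
  · rw [mul_smul, ← h, inv_smul_smul]

theorem ProImage.isStone [Infinite 𝔸] (h𝒬 : Codirected 𝒬) :
    (ProImage.topology h𝒬).IsStone where
  isCompact := ProImage.isCompact h𝒬
  isHausdorff := ProImage.isHausdorff h𝒬
  exists_basis := by
    have hsingle : ∀ (q : 𝒬) (z : q.1.Quot), FinSupp 𝔸 ({z} : Set q.1.Quot) := fun q =>
      Equivariant.finSupp_preimage_singleton (f := id) fun _ _ => rfl
    let ℬ : Set (Set (ProImage 𝒬)) := {B | ∃ (q : 𝒬) (z : q.1.Quot), B = ProImage.proj q ⁻¹' {z}}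
    have hℬ : ∀ (π : FinPerm 𝔸), ∀ B ∈ ℬ, π • B ∈ ℬ := by
      rintro π _ ⟨q, z, rfl⟩
      exact ⟨q, π • z, by
        rw [(ProImage.proj_equivariant q).smul_preimage, Set.smul_set_singleton]⟩
    refine ⟨ℬ, ⟨?_, hℬ, fun U hU => ?_⟩, ?_⟩
    · rintro _ ⟨q, z, rfl⟩
      exact ProImage.isOpen_proj_preimage h𝒬 q (hsingle q z)
    · refine ⟨{B ∈ ℬ | B ⊆ U}, fun _ h => h.1, ?_, Set.Subset.antisymm (fun e he => ?_)
        (Set.sUnion_subset fun _ h => h.2)⟩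
      · obtain ⟨S, hS⟩ := hU.1
        refine ⟨S, supports_of_smul_mem fun π hπ B hB => ⟨hℬ π B hB.1, ?_⟩⟩
        rw [← hS π hπ]
        exact Set.smul_set_mono hB.2
      · obtain ⟨q, hq⟩ := hU.2 e he
        exact ⟨ProImage.proj q ⁻¹' {e.proj q}, ⟨⟨q, _, rfl⟩, hq⟩, rfl⟩
    · rintro _ ⟨q, z, rfl⟩
      exact ⟨q.1.Quot, inferInstance, ProImage.proj q, {z}, inferInstance, q.1.orbitFinite,
        ProImage.isMorphism_proj h𝒬 q, hsingle q z, rfl⟩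

/-- Morphisms from `ProImage 𝒬` to discrete nominal sets factorize through one of the
projections. -/
theorem ProImage.exists_factor [Infinite 𝔸] (h𝒬 : Codirected 𝒬) {Y : Type u}
    [MulAction (FinPerm 𝔸) Y] [IsNominal 𝔸 Y] {g : ProImage 𝒬 → Y}
    (hg : IsMorphism (ProImage.topology h𝒬) (NomTop.discrete 𝔸 Y) g) :
    ∃ q : 𝒬, ∀ d e : ProImage 𝒬, d.proj q = e.proj q → g d = g e := by
  -- The cover by all fibres of projections on which `g` is constant; continuity of `g` makes it a
  -- cover, and equivariance makes the family invariant.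
  let 𝒞 : Set (Set (ProImage 𝒬)) := {U | ∃ (q : 𝒬) (z : q.1.Quot),
    U = ProImage.proj q ⁻¹' {z} ∧ ∀ d ∈ U, ∀ e ∈ U, g d = g e}
  have h𝒞 : ∀ (π : FinPerm 𝔸), ∀ U ∈ 𝒞, π • U ∈ 𝒞 := by
    rintro π _ ⟨q, z, rfl, h⟩
    refine ⟨q, π • z, ?_, ?_⟩
    · rw [(ProImage.proj_equivariant q).smul_preimage, Set.smul_set_singleton]
    · rintro _ ⟨d, hd, rfl⟩ _ ⟨e, he, rfl⟩
      exact (hg.equivariant π d).trans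
        ((congrArg (π • ·) (h d hd e he)).trans (hg.equivariant π e).symm)
  obtain ⟨𝒟, h𝒟𝒞, -, hcover, hfin⟩ := ProImage.isCompact h𝒬 𝒞
    ⟨∅, supports_of_smul_mem fun π _ => h𝒞 π⟩
    (by
      rintro _ ⟨q, z, rfl, -⟩
      exact ProImage.isOpen_proj_preimage h𝒬 q
        (Equivariant.finSupp_preimage_singleton (f := id) (fun _ _ => rfl) z))
    (Set.eq_univ_of_forall fun d => by
      obtain ⟨q, hq⟩ := (hg.continuous {g d}
        (Equivariant.finSupp_preimage_singleton (f := id) (fun _ _ => rfl) (g d))).2 d rfl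
      exact ⟨_, ⟨q, d.proj q, rfl, fun e he e' he' => (hq e he).trans (hq e' he').symm⟩, rfl⟩)
  obtain ⟨F, hF𝒟, hFfin, hF⟩ := Set.exists_subset_image_finite_and.1
    ⟨_, Set.Subset.rfl, hfin, rfl⟩
  have hq : ∀ U : 𝒞, ∃ q : 𝒬, ∃ z : q.1.Quot, (U : Set (ProImage 𝒬)) = ProImage.proj q ⁻¹' {z} :=
    fun U => by
      obtain ⟨q, z, h, -⟩ := U.2
      exact ⟨q, z, h⟩
  choose q z hqz using hq
  have := hFfin.to_subtype
  -- One quotient per orbit of the subcover suffices, since a translate of a fibre of a projection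
  -- is again a fibre of the same projection. Points with equal projection to `r` thus lie in the
  -- same members of the subcover.
  obtain ⟨r, hr, hrq⟩ := h𝒬 (Set.range fun U : F => (q ⟨U, h𝒟𝒞 (hF𝒟 U.2)⟩).1)
    (by rintro _ ⟨U, rfl⟩; exact (q _).2) (Set.finite_range _)
  refine ⟨⟨r, hr⟩, fun d e hde => ?_⟩
  obtain ⟨V, hV, hdV⟩ : d ∈ ⋃₀ 𝒟 := hcover ▸ Set.mem_univ d
  obtain ⟨U, hU, hUV⟩ : MulAction.orbit (FinPerm 𝔸) V ∈
      MulAction.orbit (FinPerm 𝔸) '' F := hF ▸ ⟨V, hV, rfl⟩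
  obtain ⟨π, rfl⟩ : V ∈ MulAction.orbit (FinPerm 𝔸) U := hUV ▸ MulAction.mem_orbit_self V
  have heV : e ∈ π • U := by
    have hU𝒞 := hqz ⟨U, h𝒟𝒞 (hF𝒟 hU)⟩
    dsimp only at hU𝒞 hdV ⊢
    rw [hU𝒞, (ProImage.proj_equivariant _).smul_preimage, Set.mem_preimage] at hdV ⊢
    rwa [← ProImage.proj_congr (q := ⟨r, hr⟩) (hrq _ ⟨⟨U, hU⟩, rfl⟩) hde]
  obtain ⟨-, -, -, h⟩ := h𝒟𝒞 hV
  exact h d hdV e heV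

end ProImage

/-! ### Standard strong alphabets -/

section Alphabet

/-- The strong nominal set of pairs consisting of one of `n` labels and an injective `k`-tuple of
names. -/
def TupleAlphabet (𝔸 : Type) (n k : ℕ) : Type u :=
  ULift.{u} (Fin n × (Fin k ↪ 𝔸))

variable {𝔸 : Type} {n k : ℕ}

instance : MulAction (FinPerm 𝔸) (TupleAlphabet.{u} 𝔸 n k) where
  smul π x := ⟨(x.down.1, π • x.down.2)⟩
  one_smul x := congrArg (fun f => (⟨(x.down.1, f)⟩ : TupleAlphabet 𝔸 n k)) (one_smul _ x.down.2)
  mul_smul π σ x :=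
    congrArg (fun f => (⟨(x.down.1, f)⟩ : TupleAlphabet 𝔸 n k)) (mul_smul π σ x.down.2)

/-- The label of a letter. -/
def TupleAlphabet.label (x : TupleAlphabet.{u} 𝔸 n k) : Fin n := x.down.1

/-- The tuple of names of a letter. -/
def TupleAlphabet.names (x : TupleAlphabet.{u} 𝔸 n k) : Fin k ↪ 𝔸 := x.down.2

/-- The letter with the given label and names. -/
def TupleAlphabet.mk (i : Fin n) (f : Fin k ↪ 𝔸) : TupleAlphabet.{u} 𝔸 n k := ⟨(i, f)⟩

theorem TupleAlphabet.ext {x y : TupleAlphabet.{u} 𝔸 n k} (h₁ : x.label = y.label)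
    (h₂ : ∀ j, x.names j = y.names j) : x = y :=
  congrArg ULift.up (Prod.ext h₁ (DFunLike.ext _ _ h₂))

theorem TupleAlphabet.names_smul (π : FinPerm 𝔸) (x : TupleAlphabet.{u} 𝔸 n k) (j : Fin k) :
    (π • x).names j = π • x.names j := rfl

theorem TupleAlphabet.smul_eq_iff {π : FinPerm 𝔸} {x : TupleAlphabet.{u} 𝔸 n k} :
    π • x = x ↔ ∀ a ∈ Set.range x.names, π • a = a := by
  constructor
  · rintro h _ ⟨j, rfl⟩
    rw [← names_smul, h]
  · exact fun h => ext rfl fun j => h _ ⟨j, rfl⟩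

theorem TupleAlphabet.supports_range (x : TupleAlphabet.{u} 𝔸 n k) :
    MulAction.Supports (FinPerm 𝔸) (Set.range x.names) x :=
  fun _ hπ => smul_eq_iff.2 fun _ ha => hπ ha

instance : IsNominal 𝔸 (TupleAlphabet.{u} 𝔸 n k) where
  finSupp x := ⟨(Set.finite_range x.names).toFinset, by simpa using x.supports_range⟩

theorem TupleAlphabet.supp_eq [Infinite 𝔸] (x : TupleAlphabet.{u} 𝔸 n k) :
    supp 𝔸 x = Set.range x.names := by
  classical
  refine (supp_subset (Set.finite_range _) x.supports_range).antisymm ?_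
  intro a ha S hS
  by_contra haS
  obtain ⟨b, hb⟩ := Infinite.exists_notMem_finset (insert a S)
  rw [Finset.mem_insert, not_or] at hb
  have h := smul_eq_iff.1 (hS (FinPerm.swap a b) fun c hc => FinPerm.swap_smul_of_ne
    (fun h => haS (h ▸ hc)) fun h => hb.2 (h ▸ hc)) a ha
  rw [FinPerm.swap_smul_left] at h
  exact hb.1 h

theorem TupleAlphabet.isStrong [Infinite 𝔸] : IsStrong 𝔸 (TupleAlphabet.{u} 𝔸 n k) :=
  fun x π => by rw [smul_eq_iff, supp_eq]

theorem TupleAlphabet.exists_smul_eq {x y : TupleAlphabet.{u} 𝔸 n k} (h : x.label = y.label) :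
    ∃ π : FinPerm 𝔸, π • x = y := by
  classical
  let f : 𝔸 → 𝔸 := fun a => if ha : a ∈ Set.range x.names then y.names ha.choose else a
  have hf : ∀ j, f (x.names j) = y.names j := fun j => by
    have hj : x.names j ∈ Set.range x.names := ⟨j, rfl⟩
    rw [show f (x.names j) = y.names hj.choose from dif_pos hj,
      x.names.injective hj.choose_spec]
  obtain ⟨π, hπ⟩ := exists_finPerm_eqOn (Finset.univ.map x.names) f (by
    intro a ha b hb hab
    obtain ⟨i, -, rfl⟩ := Finset.mem_map.1 ha
    obtain ⟨j, -, rfl⟩ := Finset.mem_map.1 hb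
    rw [hf, hf] at hab
    rw [y.names.injective hab])
  exact ⟨π, ext h fun j => by rw [names_smul, hπ _ (by simp), hf]⟩

theorem TupleAlphabet.orbitFinite : OrbitFinite 𝔸 (TupleAlphabet.{u} 𝔸 n k) := by
  refine Finite.of_injective (β := Fin n) (Quotient.lift TupleAlphabet.label ?_) ?_
  · rintro _ y ⟨π, rfl⟩
    rfl
  · intro a b
    induction a using Quotient.inductionOn' with | _ a
    induction b using Quotient.inductionOn' with | _ b
    intro h
    obtain ⟨π, rfl⟩ := exists_smul_eq (x := b) (y := a) h.symm
    exact Quotient.sound' ⟨π, rfl⟩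

/-- Every orbit-finite nominal set is the image of a standard strong alphabet. -/
theorem OrbitFinite.exists_tupleAlphabet [Infinite 𝔸] {X : Type u} [MulAction (FinPerm 𝔸) X]
    [IsNominal 𝔸 X] (hX : OrbitFinite 𝔸 X) :
    ∃ (n k : ℕ) (f : TupleAlphabet.{u} 𝔸 n k → X), Equivariant 𝔸 f ∧ Function.Surjective f := by
  obtain ⟨k, hk⟩ := hX.exists_isBounded
  obtain ⟨R, hR, hrep⟩ := hX.exists_finite_reps
  obtain ⟨n, r, -, rfl⟩ := hR.fin_param
  obtain ⟨f, hf, hfr⟩ := TupleAlphabet.isStrong.exists_equivariant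
    (X := TupleAlphabet.{u} 𝔸 n k) (fun x y => ∃ π : FinPerm 𝔸, π • r x.label = y)
    (by
      rintro π x _ ⟨σ, rfl⟩
      exact ⟨π * σ, mul_smul _ _ _⟩)
    (fun x => by
      obtain ⟨B, hB, -⟩ := (IsNominal.finSupp (𝔸 := 𝔸) (r x.label)).exists_finset
      -- Since `k` bounds all supports, the support of the representative can be moved among the `k`
      -- names of the letter, as the construction of an equivariant map requires.
      obtain ⟨π, -, hπ⟩ := exists_finPerm_mapsTo (T := Finset.univ.map x.names)
        (Finset.empty_subset _) B (by
          have := hk (r x.label)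
          rw [← hB, Set.encard_coe_eq_coe_finsetCard] at this
          have : B.card ≤ k := by exact_mod_cast this
          simpa using this)
      refine ⟨_, ⟨π, rfl⟩, ?_⟩
      rw [TupleAlphabet.supp_eq, supp_smul (IsNominal.finSupp _), ← hB]
      rintro _ ⟨a, ha, rfl⟩
      simpa using hπ a ha)
  refine ⟨n, k, f, hf, fun y => ?_⟩
  obtain ⟨_, ⟨i, rfl⟩, π, rfl⟩ := hrep y
  let x : TupleAlphabet.{u} 𝔸 n k :=
    TupleAlphabet.mk i ⟨fun j => Infinite.natEmbedding 𝔸 j, fun j l h =>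
      Fin.ext ((Infinite.natEmbedding 𝔸).injective h)⟩
  obtain ⟨σ, hσ⟩ := hfr x
  refine ⟨π • σ⁻¹ • x, ?_⟩
  rw [hf, hf, ← hσ, inv_smul_smul]
  rfl

end Alphabet

/-! ### The proequations of an MSR-pseudovariety -/

section Presentation

variable {𝔸 : Type} [Infinite 𝔸] {𝒱 : Set (NomMon.{u} 𝔸)}

/-- The morphic proequation of an MSR-pseudovariety over a standard alphabet. -/
def IsMSRPseudovariety.proequation (h𝒱 : IsMSRPseudovariety 𝒱) (n k : ℕ)
    (s : SupportBound 𝔸 (TupleAlphabet.{u} 𝔸 n k)) : MorphicProequation.{u} 𝔸 where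
  Alphabet := TupleAlphabet.{u} 𝔸 n k
  alphabet_orbitFinite := TupleAlphabet.orbitFinite
  alphabet_strong := TupleAlphabet.isStrong
  bound := s
  Codomain := ProImage (quotientsIn 𝒱 s)
  topology := ProImage.topology (codirected_quotientsIn h𝒱 s)
  isStone := ProImage.isStone _
  map := ProWord.restrict _
  isMorphism := ProWord.isMorphism_restrict _
  surjective := ProWord.restrict_surjective

theorem IsMSRPseudovariety.satisfies (h𝒱 : IsMSRPseudovariety 𝒱) {n k : ℕ}
    {s : SupportBound 𝔸 (TupleAlphabet.{u} 𝔸 n k)} {M : NomMon.{u} 𝔸} (hM : M ∈ 𝒱) :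
    Satisfies M (h𝒱.orbitFinite M hM) (h𝒱.proequation n k s) := by
  rw [satisfies_iff]
  intro h hh
  let q : quotientsIn 𝒱 s := ⟨_, coimage_mem_quotientsIn h𝒱 hM (h𝒱.orbitFinite M hM) h hh⟩
  exact ⟨EqvCon.kerLift h hh.equivariant ∘ ProImage.proj q,
    (ProImage.isMorphism_proj (codirected_quotientsIn h𝒱 s) q).comp_discrete
      (EqvCon.kerLift_smul h hh.equivariant), fun _ => rfl⟩

/-- The support bound given by the supports of the values of a morphism. -/
theorem exists_supportBound {Sg : Type u} [MulAction (FinPerm 𝔸) Sg] {M : NomMon.{u} 𝔸}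
    (hM : OrbitFinite 𝔸 M) (h : FreeMonoid Sg →* M) :
    ∃ s : SupportBound 𝔸 Sg, ∀ w, (s w : Set 𝔸) = supp 𝔸 (h w) := by
  obtain ⟨k, hk⟩ := hM.exists_isBounded
  choose S hS using fun w => (IsNominal.finSupp (𝔸 := 𝔸) (h w)).exists_finset
  refine ⟨⟨S, k, fun w => ?_⟩, fun w => (hS w).1⟩
  have := hk (h w)
  rw [← (hS w).1, Set.encard_coe_eq_coe_finsetCard] at this
  exact_mod_cast this

/-- The bound `s w = supp (H w)` is the smallest one for which `H` is `s`-bounded. It leaves the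
quotient `q` no room for larger supports than `M`, which turns the induced surjection onto `M` into
an MSR quotient. -/
theorem IsMSRPseudovariety.mem_of_satisfies (h𝒱 : IsMSRPseudovariety 𝒱) {M : NomMon.{u} 𝔸}
    (hM : OrbitFinite 𝔸 M) (h : ∀ n k s, Satisfies M hM (h𝒱.proequation n k s)) : M ∈ 𝒱 := by
  obtain ⟨n, k, f, hf, hsurj⟩ := hM.exists_tupleAlphabet
  let H : FreeMonoid (TupleAlphabet.{u} 𝔸 n k) →* M := FreeMonoid.lift f
  have hH : Equivariant 𝔸 H := equivariant_lift hf
  obtain ⟨s, hs⟩ := exists_supportBound hM H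
  have hb : IsBoundedMorphism s H := ⟨hH, fun w => (hs w).ge⟩
  obtain ⟨g, hg, hgH⟩ := satisfies_iff.1 (h n k s) H hb
  obtain ⟨q, hq⟩ := ProImage.exists_factor (codirected_quotientsIn h𝒱 s) hg
  have hker : q.1.con ≤ Con.ker H := fun v w hvw => by
    -- On the pro-orbit-finite word given by `w`, `Ĥ` takes the value `H w`; hence words identified
    -- by `q` are identified by `H`.
    have := hq ((ProWord.ofWord s v).restrict _) ((ProWord.ofWord s w).restrict _)
      ((Con.eq _).2 hvw)
    exact (hgH (ProWord.ofWord s v)).trans (this.trans (hgH (ProWord.ofWord s w)).symm)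
  let e : q.1.toNomMon →* M := q.1.con.lift H hker
  have he : ∀ w, e (q.1.quotMk w) = H w := fun _ => rfl
  refine h𝒱.of_surjective (M := q.1.toNomMon) (e := e) q.2 ?_ ?_ ?_
  · intro π x
    obtain ⟨w, rfl⟩ := q.1.quotMk_surjective x
    exact hH π w
  · intro y
    obtain ⟨x, rfl⟩ := hsurj y
    exact ⟨q.1.quotMk (FreeMonoid.of x), FreeMonoid.lift_eval_of f x⟩
  · intro x
    obtain ⟨w, rfl⟩ := q.1.quotMk_surjective x
    exact (q.1.bounded.supp_subset w).trans (hs w).le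

theorem IsMSRPseudovariety.isPresentable (h𝒱 : IsMSRPseudovariety 𝒱) : IsPresentable 𝒱 := by
  -- Restricting to the standard alphabets keeps the index type in `Type u`, so the proequations
  -- form a set.
  refine ⟨Set.range fun i : Σ n k, SupportBound 𝔸 (TupleAlphabet.{u} 𝔸 n k) =>
    h𝒱.proequation i.1 i.2.1 i.2.2, inferInstance, fun M => ⟨fun hM => ?_, ?_⟩⟩
  · refine ⟨h𝒱.orbitFinite M hM, ?_⟩
    rintro _ ⟨i, rfl⟩
    exact h𝒱.satisfies hM
  · rintro ⟨hM, h⟩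
    exact h𝒱.mem_of_satisfies hM fun n k s => h _ ⟨⟨n, k, s⟩, rfl⟩

end Presentation

end Nominal

theorem mainTheorem5 (𝔸 : Type) [Countable 𝔸] [Infinite 𝔸]
    (𝒱 : Set (Nominal.NomMon.{u} 𝔸)) (h𝒱 : ∀ M ∈ 𝒱, Nominal.OrbitFinite 𝔸 M) :
    Nominal.IsMSRPseudovariety 𝒱 ↔ Nominal.IsPresentable 𝒱 :=
  ⟨fun h => h.isPresentable, fun h => h.isMSRPseudovariety⟩
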